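/- Let $\mathbb{H}$ be the real quaternions, $\mathbb{S}=\{I\in\mathbb{H}: I^2=-1\}$ and, for $I\in\mathbb{S}$, let $\mathbb{C}_I=\mathbb{R}+\mathbb{R}I$ with Lebesgue measure $d\lambda_I$. Put $$\langle f,g\rangle_{\mathbb{C}_I}=\int_{\mathbb{C}_I}\overline{f(q)}\,g(q)\,e^{-|q|^2}\,d\lambda_I(q).$$ A function $f:\mathbb{H}\to\mathbb{H}$ is S-polyregular of level $n$ if it is real differentiable and, for every $I\in\mathbb{S}$, its restriction $F(x,y)=f(x+Iy)$ to $\mathbb{C}_I$ is of class $C^{n+1}$ with $\overline{\partial_I}^{\,n+1}F=0$, where $\overline{\partial_I}=\frac12(\partial_x+I\partial_y)$. Let $\mathcal{SR}^2_{1,n}$ be the set of functions $f(q)=\sum_{k=0}^n\sum_{j=0}^\infty \overline{q}^kq^j\alpha_{j,k}$, with $\alpha_{j,k}\in\mathbb{H}$ and the series convergent on $\mathbb{H}$, that are S-polyregular of level $n$ and belong to $L^2(\mathbb{C}_{I_0};e^{-|q|^2}d\lambda_{I_0})$ for some $I_0\in\mathbb{S}$. Let $\mathcal{SR}^2_{2,k}$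 be the set of functions $\sum_{j\ge0}H^Q_{j,k}(q,\overline q)c_j$ with $c_j\in\mathbb{H}$ and $\sum_j j!\,|c_j|^2<\infty$, where $$H^Q_{m,n}(q,\overline q)=m!\,n!\sum_{i=0}^{\min(m,n)}\frac{(-1)^i}{i!}\frac{q^{m-i}\,\overline q^{\,n-i}}{(m-i)!\,(n-i)!}.$$ For series in the variable $q$, the left star product is $$\Big(\sum_{k}\sum_{j}\overline q^kq^ja_{j,k}\Big)\star_{sp}\Big(\sum_{l}\sum_{i}\overline q^lq^ib_{i,l}\Big)=\sum_{k,l}\overline q^{\,k+l}\sum_{m\ge0}q^m\sum_{j+i=m}a_{j,k}b_{i,l}$$ (with finitely many powers of $\overline q$ in each factor). For $p\in\mathbb{H}$ set $e_*^{[q,\overline p]}=\sum_{j\ge0}\frac{q^j\,\overline p^{\,j}}{j!}$ and $|q-p|^2_\star=(q-p)\star_{sp}(\overline q-\overline p)$, the star product being taken in $q$. Let $L^{(a)}_{\star m}(|q-p|_\star^2)$ be the Laguerre polynomial $L_m^{(a)}(x)=\sum_{k=0}^m\frac{(a+m)!}{(m-k)!\,(a+k)!}\frac{(-x)^k}{k!}$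 evaluated at $|q-p|_\star^2$ with $\star_{sp}$-powers, and let $L_{\star m}=L^{(0)}_{\star m}$. **Theorem.** Let $n,k\ge0$ be integers and $I\in\mathbb{S}$. With the inner product $\langle\cdot,\cdot\rangle_{\mathbb{C}_I}$, the spaces $\mathcal{SR}^2_{1,n}$ and $\mathcal{SR}^2_{2,k}$ are right quaternionic Hilbert spaces with continuous point evaluations. Their reproducing kernels are given, by everywhere convergent series and independently of $I$, by $$\mathcal{K}_{1,n}(p,q)=\frac1\pi\,e_*^{[q,\overline p]}\star_{sp}L^{(1)}_{\star n}(|q-p|^2_\star),\qquad \mathcal{K}_{2,k}(p,q)=\frac1\pi\,e_*^{[q,\overline p]}\star_{sp}L_{\star k}(|q-p|^2_\star).$$ That is, for all $p\in\mathbb{H}$, $\mathcal{K}_{1,n}(p,\cdot)\in\mathcal{SR}^2_{1,n}$ and $\mathcal{K}_{2,k}(p,\cdot)\in\mathcal{SR}^2_{2,k}$, and $$f(p)=\langle\mathcal{K}_{1,n}(p,\cdot),f\rangle_{\mathbb{C}_I},\qquad g(p)=\langle\mathcal{K}_{2,k}(p,\cdot),g\rangle_{\mathbb{C}_I}$$ for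 all $f\in\mathcal{SR}^2_{1,n}$ and $g\in\mathcal{SR}^2_{2,k}$. Moreover $\overline{\mathcal{K}(p,q)}=\mathcal{K}(q,p)$ for all $p,q\in\mathbb{H}$ and both families of kernels. -/

import Mathlib

open MeasureTheory
open scoped Quaternion Nat

noncomputable section

/-! ### Slices of the quaternions -/

/-- The sphere `𝕊` of quaternionic imaginary units. -/
def imagUnits : Set ℍ[ℝ] := {I | I ^ 2 = -1}

/-- The parametrization `x + iy ↦ x + Iy` of the slice `ℂ_I = ℝ + ℝI`. -/
def slice (I : ℍ[ℝ]) (z : ℂ) : ℍ[ℝ] := (z.re : ℍ[ℝ]) + I * (z.im : ℍ[ℝ])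

/-- The operator `∂̄_I = (∂/∂x + I ∂/∂y) / 2`, acting on functions of `z = x + iy`. -/
def dbar (I : ℍ[ℝ]) (F : ℂ → ℍ[ℝ]) (z : ℂ) : ℍ[ℝ] :=
  (1 / 2 : ℝ) • (fderiv ℝ F z 1 + I * fderiv ℝ F z Complex.I)

/-- `f ∈ 𝒮ℛ_n`: `f` is real differentiable on the quaternions and its restriction to every slice is
polyanalytic of order `n + 1`. -/
def IsSPolyregular (n : ℕ) (f : ℍ[ℝ] → ℍ[ℝ]) : Prop :=
  Differentiable ℝ f ∧ ∀ I ∈ imagUnits,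
    ContDiff ℝ ((n + 1 : ℕ) : WithTop ℕ∞) (fun z => f (slice I z)) ∧
      ∀ z, (dbar I)^[n + 1] (fun w => f (slice I w)) z = 0

/-! ### Gaussian inner product on a slice -/

/-- The measure `e^{-|z|²} dx dy`. -/
def gaussMeasure : Measure ℂ :=
  volume.withDensity fun z => ENNReal.ofReal (Real.exp (-‖z‖ ^ 2))

/-- Square integrability on the slice `ℂ_I` with respect to the Gaussian measure. -/
def SliceL2 (I : ℍ[ℝ]) (f : ℍ[ℝ] → ℍ[ℝ]) : Prop :=
  MemLp (fun z => f (slice I z)) 2 gaussMeasure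

/-- `⟨f, g⟩_{ℂ_I} = ∫_{ℂ_I} \overline{f(q)} g(q) e^{-|q|²} dλ_I(q)`. -/
def sliceInner (I : ℍ[ℝ]) (f g : ℍ[ℝ] → ℍ[ℝ]) : ℍ[ℝ] :=
  ∫ z, star (f (slice I z)) * g (slice I z) ∂gaussMeasure

/-- The norm induced by `sliceInner I`. -/
def sliceNorm (I : ℍ[ℝ]) (f : ℍ[ℝ] → ℍ[ℝ]) : ℝ :=
  Real.sqrt (sliceInner I f f).re

/-! ### Series in `q`, `q̄` with right coefficients, and the star product -/

/-- Coefficient data of the series `∑_k q̄^k ∑_j q^j α_{j,k}`, finite in `k`, with quaternionic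
coefficients on the right: the polynomial variable stands for `q̄`, the power series variable
for `q`.

Both variables are central, so that multiplication in this ring is the left star product `⋆_sp`:
`(∑_j q̄^j φ_j) ⋆_sp (∑_k q̄^k ψ_k) = ∑_{j,k} q̄^{j+k} (φ_j ⋆_s ψ_k)`, where
`(∑ q^m a_m) ⋆_s (∑ q^m b_m) = ∑ q^m (∑_{i ≤ m} a_i b_{m-i})`. -/
abbrev SPSeries : Type := Polynomial (PowerSeries ℍ[ℝ])

/-- The general term `q̄^k q^j α_{j,k}` of the series. -/
def spTerm (F : SPSeries) (q : ℍ[ℝ]) (k j : ℕ) : ℍ[ℝ] :=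
  star q ^ k * q ^ j * PowerSeries.coeff j (F.coeff k)

/-- The series converges everywhere. -/
def SPConverges (F : SPSeries) : Prop := ∀ q k, Summable (spTerm F q k)

/-- The sum of the series at `q`. -/
def spEval (F : SPSeries) (q : ℍ[ℝ]) : ℍ[ℝ] :=
  ∑ k ∈ Finset.range (F.natDegree + 1), ∑' j, spTerm F q k j

/-- The function `q ↦ q`. -/
def spVar : SPSeries := Polynomial.C PowerSeries.X

/-- The function `q ↦ q̄`. -/
def spVarConj : SPSeries := Polynomial.X

/-- The constant function `q ↦ a`. -/
def spConst (a : ℍ[ℝ]) : SPSeries := Polynomial.C (PowerSeries.C a)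

/-- The function `q ↦ e_*^{[q, b]} = ∑_j q^j b^j / j!`. -/
def starExp (b : ℍ[ℝ]) : SPSeries :=
  Polynomial.C (PowerSeries.mk fun j => ((j ! : ℝ))⁻¹ • b ^ j)

/-- The function `q ↦ |q - p|²_⋆ = (q - p) ⋆_sp (q̄ - p̄)`, the star product being taken in `q`. -/
def starDistSq (p : ℍ[ℝ]) : SPSeries :=
  (spVar - spConst p) * (spVarConj - spConst (star p))

/-- The generalized Laguerre polynomial
`L_m^{(a)}(x) = ∑_{k ≤ m} (a+m)! / ((m-k)! (a+k)!) (-x)^k / k!`, for a natural number `a`. -/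
def laguerre (a m : ℕ) : Polynomial ℝ :=
  ∑ k ∈ Finset.range (m + 1), Polynomial.C
    ((-1 : ℝ) ^ k * ((a + m)! : ℝ) / (((m - k)! : ℝ) * ((a + k)! : ℝ) * (k ! : ℝ))) *
      Polynomial.X ^ k

/-- `L^{(a)}_{⋆ m}(|q - p|²_⋆)`: the Laguerre polynomial, with powers taken for the star product. -/
def starLaguerre (a m : ℕ) (p : ℍ[ℝ]) : SPSeries :=
  Polynomial.aeval (starDistSq p) (laguerre a m)

/-- `(1/π) e_*^{[q, p̄]} ⋆_sp L^{(a)}_{⋆ m}(|q - p|²_⋆)`, as a series in `q`, `q̄`. -/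
def kernelSeries (a m : ℕ) (p : ℍ[ℝ]) : SPSeries :=
  (Real.pi)⁻¹ • (starExp (star p) * starLaguerre a m p)

/-! ### The Bargmann spaces -/

/-- The quaternionic Hermite polynomial `H^Q_{m,k}(q, q̄)`. -/
def hermiteQ (m k : ℕ) (q : ℍ[ℝ]) : ℍ[ℝ] :=
  ∑ i ∈ Finset.range (min m k + 1),
    ((-1 : ℝ) ^ i * (m ! : ℝ) * (k ! : ℝ) / ((i ! : ℝ) * ((m - i)! : ℝ) * ((k - i)! : ℝ))) •
      (q ^ (m - i) * star q ^ (k - i))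

/-- The S-polyregular Bargmann space of first kind and level `n`: the sums of everywhere convergent
series `∑_{k ≤ n} ∑_j q̄^k q^j α_{j,k}` which are S-polyregular of level `n` and square integrable
on some slice. -/
def bargmannFirst (n : ℕ) : Set (ℍ[ℝ] → ℍ[ℝ]) :=
  {f | (∃ F : SPSeries, F.natDegree ≤ n ∧ SPConverges F ∧ ∀ q, f q = spEval F q) ∧
    IsSPolyregular n f ∧ ∃ I ∈ imagUnits, SliceL2 I f}

/-- The S-polyregular Bargmann space of second kind and exact level `k`. -/
def bargmannSecond (k : ℕ) : Set (ℍ[ℝ] → ℍ[ℝ]) :=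
  {f | ∃ c : ℕ → ℍ[ℝ], Summable (fun j => (j ! : ℝ) * ‖c j‖ ^ 2) ∧
    ∀ q, HasSum (fun j => hermiteQ j k q * c j) (f q)}

/-! ### Reproducing kernel Hilbert spaces -/

/-- `V` is a right quaternionic Hilbert space for the inner product `⟨·,·⟩_{ℂ_I}`. -/
structure IsRightHilbert (I : ℍ[ℝ]) (V : Set (ℍ[ℝ] → ℍ[ℝ])) : Prop where
  zero_mem : (fun _ => 0) ∈ V
  add_mem : ∀ f ∈ V, ∀ g ∈ V, (fun q => f q + g q) ∈ V
  mul_mem : ∀ f ∈ V, ∀ a : ℍ[ℝ], (fun q => f q * a) ∈ V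
  memL2 : ∀ f ∈ V, SliceL2 I f
  definite : ∀ f ∈ V, sliceInner I f f = 0 → ∀ q, f q = 0
  complete : ∀ u : ℕ → ℍ[ℝ] → ℍ[ℝ], (∀ m, u m ∈ V) →
    (∀ ε > 0, ∃ N, ∀ m ≥ N, ∀ l ≥ N, sliceNorm I (fun q => u m q - u l q) < ε) →
    ∃ f ∈ V, ∀ ε > 0, ∃ N, ∀ m ≥ N, sliceNorm I (fun q => u m q - f q) < ε

/-- `V` is a right quaternionic Hilbert space with continuous point evaluations whose reproducing
kernel is `K`: every `K(p, ·)` lies in `V`, and `f(p) = ⟨K(p, ·), f⟩_{ℂ_I}`. The Hermitian symmetry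
turns the latter into `f(p) = ∫_{ℂ_I} K(q, p) f(q) e^{-|q|²} dλ_I(q)`. -/
structure IsReproducingKernelSpace (I : ℍ[ℝ]) (V : Set (ℍ[ℝ] → ℍ[ℝ]))
    (K : ℍ[ℝ] → ℍ[ℝ] → ℍ[ℝ]) : Prop where
  hilbert : IsRightHilbert I V
  eval_bounded : ∀ p, ∃ C : ℝ, ∀ f ∈ V, ‖f p‖ ≤ C * sliceNorm I f
  kernel_mem : ∀ p, K p ∈ V
  reproducing : ∀ f ∈ V, ∀ p, f p = sliceInner I (K p) f
  hermitian : ∀ p q, star (K p q) = K q p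

end

/-!
The Hermite polynomials `H_{j,k}(q, q̄)` have real coefficients, so on each slice `ℂ_I` they are
copies of the complex Hermite polynomials and are orthogonal there, with `‖H_{j,k}‖² = π j! k!`
whatever `I` is (`integral_star_hermiteC_mul_hermiteC`). For any family `e_i` which is orthonormal
on `ℂ_I` and has `∑ |e_i(q)|² < ∞` for all `q`, the sums `∑ e_i c_i` with square summable `c_i`
form a copy of `ℓ²`, and hence a reproducing kernel Hilbert space with kernel
`K(p, q) = ∑ e_i(q) \overline{e_i(p)}` (`IsSliceOrthonormal.isReproducingKernelSpace`). It remains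
to show that both Bargmann spaces are of this form and that these kernels have the stated closed
form.

*The kernels.* In the ring of formal series, in which `q` and `q̄` are central and multiplication
is the star product, `H_{j,k} = (q̄ - ∂_q)^k q^j`, and `∑_j q^j \overline{H_{j,k}(p)} / j!` equals
`(p - q)^k ⋆ e_*^{[q, p̄]}`. Therefore `∑_j H_{j,k}(q) \overline{H_{j,k}(p)} / j!` is
`(q̄ - ∂_q)^k ((p - q)^k ⋆ e_*^{[q, p̄]})`. Moving the exponential past the operator turns the
latter into `q̄ - p̄ - ∂_q`, and expanding its `k`-th power gives
`k! e_*^{[q, p̄]} ⋆ L_{⋆k}(|q - p|²_⋆)` (`kernelSeries_zero`). Summing over `k ≤ n` replaces `L_k`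
by `L_n^{(1)}` (`kernelSeries_one`).

*The space of second kind* is a span of the required form by definition, up to normalization.

*The space of first kind.* Since `(q̄ - ∂_q)^k φ(q)` has the leading term `q̄^k φ(q)`, each
everywhere convergent series of degree `n` in `q̄` is a sum of Hermite series `∑_j H_{j,k} c_{j,k}`,
`k ≤ n`, the coefficients of which are those of entire series (`SPConverges.exists_eq_sum_raise`).
If its sum `f` is square integrable on `ℂ_I`, then `⟨H_{j,k}, f⟩ = π j! k! c_{j,k}`: on a disc the
series may be integrated term by term, and by rotation invariance only finitely many terms
contribute, so that the radius can tend to infinity (`sliceInner_hermiteQ_sum`). Bessel's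
inequality then gives the square summability of the normalized coefficients. Conversely, square
summable normalized coefficients define everywhere convergent series, whose sums are polyregular
because each `∂̄_I` lowers the degree in `q̄` by one (`SPConverges.isSPolyregular`).
-/

noncomputable section

/-! ### Reproducing kernels from an orthonormal family on a slice -/

section Abstract

variable {I : ℍ[ℝ]} {f g : ℍ[ℝ] → ℍ[ℝ]}

theorem Quaternion.inner_mul_left_eq (u a b : ℍ[ℝ]) :
    inner ℝ (a * u) b = inner ℝ u (star a * b) := by
  simp only [Quaternion.inner_def, star_mul, star_star]
  simp only [Quaternion.re_mul, Quaternion.re_star, Quaternion.imI_star, Quaternion.imJ_star,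
    Quaternion.imK_star, Quaternion.imI_mul, Quaternion.imJ_mul, Quaternion.imK_mul]
  ring

theorem Quaternion.star_mul_self_eq_norm_sq (a : ℍ[ℝ]) : star a * a = ((‖a‖ ^ 2 : ℝ) : ℍ[ℝ]) := by
  rw [Quaternion.star_mul_self, Quaternion.normSq_eq_norm_mul_self, sq]

theorem SliceL2.mul_const (hf : SliceL2 I f) (a : ℍ[ℝ]) : SliceL2 I (fun q => f q * a) :=
  ((ContinuousLinearMap.mul ℝ ℍ[ℝ]).flip a).comp_memLp' hf

theorem SliceL2.integrable_star_mul (hf : SliceL2 I f) (hg : SliceL2 I g) :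
    Integrable (fun z => star (f (slice I z)) * g (slice I z)) gaussMeasure := by
  have hf' : MemLp (fun z => star (f (slice I z))) 2 gaussMeasure := MemLp.star hf
  rw [← memLp_one_iff_integrable]
  exact MemLp.mul (p := 2) (q := 2) (r := 1) hg hf'

/-- The class in `L²` of the restriction to the slice `ℂ_I`. -/
def SliceL2.toLp (hf : SliceL2 I f) : Lp ℍ[ℝ] 2 gaussMeasure :=
  MemLp.toLp (fun z => f (slice I z)) hf

theorem SliceL2.coeFn_toLp (hf : SliceL2 I f) :
    (hf.toLp : ℂ → ℍ[ℝ]) =ᵐ[gaussMeasure] fun z => f (slice I z) :=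
  MemLp.coeFn_toLp hf

theorem SliceL2.toLp_eq_of_ae (hf : SliceL2 I f) {G : Lp ℍ[ℝ] 2 gaussMeasure}
    (h : (G : ℂ → ℍ[ℝ]) =ᵐ[gaussMeasure] fun z => f (slice I z)) : hf.toLp = G :=
  Lp.ext (hf.coeFn_toLp.trans h.symm)

theorem SliceL2.inner_toLp (hf : SliceL2 I f) (hg : SliceL2 I g) :
    inner ℝ hf.toLp hg.toLp = ∫ z, inner ℝ (f (slice I z)) (g (slice I z)) ∂gaussMeasure := by
  rw [L2.inner_def]
  refine integral_congr_ae ?_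
  filter_upwards [hf.coeFn_toLp, hg.coeFn_toLp] with z h1 h2
  rw [h1, h2]

/-- The quaternionic inner product is recovered from the real inner product of `L²`. -/
theorem SliceL2.inner_sliceInner (hf : SliceL2 I f) (hg : SliceL2 I g) (u : ℍ[ℝ]) :
    inner ℝ u (sliceInner I f g) = inner ℝ (hf.mul_const u).toLp hg.toLp := by
  rw [SliceL2.inner_toLp]
  unfold sliceInner
  rw [← integral_inner (hf.integrable_star_mul hg) u]
  simp only [Quaternion.inner_mul_left_eq]

/-- A family of functions which is orthonormal for `⟨·,·⟩_{ℂ_I}` and whose values are square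
summable at every point. -/
structure IsSliceOrthonormal {ι : Type*} (I : ℍ[ℝ]) (e : ι → ℍ[ℝ] → ℍ[ℝ]) : Prop where
  memL2 : ∀ i, SliceL2 I (e i)
  inner_self : ∀ i, sliceInner I (e i) (e i) = 1
  inner_ne : ∀ i j, i ≠ j → sliceInner I (e i) (e j) = 0
  summable : ∀ q, Summable fun i => ‖e i q‖ ^ 2

/-- The sums `∑ e_i c_i` with square summable right coefficients. -/
def sliceSpan {ι : Type*} (e : ι → ℍ[ℝ] → ℍ[ℝ]) : Set (ℍ[ℝ] → ℍ[ℝ]) :=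
  {f | ∃ c : ι → ℍ[ℝ], (Summable fun i => ‖c i‖ ^ 2) ∧ ∀ q, HasSum (fun i => e i q * c i) (f q)}

namespace IsSliceOrthonormal

variable {ι : Type*} {e : ι → ℍ[ℝ] → ℍ[ℝ]} {c d : ι → ℍ[ℝ]}

theorem inner_toLp_mul_const (he : IsSliceOrthonormal I e) (i j : ι) (a b : ℍ[ℝ]) :
    inner ℝ ((he.memL2 i).mul_const a).toLp ((he.memL2 j).mul_const b).toLp
      = inner ℝ a (sliceInner I (e i) (e j) * b) := by
  rw [SliceL2.inner_toLp]
  have h : sliceInner I (e i) (e j) * b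
      = ∫ z, star (e i (slice I z)) * e j (slice I z) * b ∂gaussMeasure :=
    (((ContinuousLinearMap.mul ℝ ℍ[ℝ]).flip b).integral_comp_comm
      ((he.memL2 i).integrable_star_mul (he.memL2 j))).symm
  rw [h, ← integral_inner]
  · simp only [Quaternion.inner_mul_left_eq, mul_assoc]
  · exact ((ContinuousLinearMap.mul ℝ ℍ[ℝ]).flip b).integrable_comp
      ((he.memL2 i).integrable_star_mul (he.memL2 j))

theorem summable_norm_mul (he : IsSliceOrthonormal I e) (hc : Summable fun i => ‖c i‖ ^ 2)
    (q : ℍ[ℝ]) : Summable fun i => ‖e i q‖ * ‖c i‖ := by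
  refine Summable.of_nonneg_of_le (fun i => by positivity) (fun i => ?_) ((he.summable q).add hc)
  nlinarith [sq_nonneg (‖e i q‖ - ‖c i‖), sq_nonneg (‖e i q‖), sq_nonneg ‖c i‖]

/-- The terms of the series `∑ e_i c_i`, as an orthogonal family in the real Hilbert space `L²`. -/
def term (he : IsSliceOrthonormal I e) (i : ι) : ℍ[ℝ] →ₗᵢ[ℝ] Lp ℍ[ℝ] 2 gaussMeasure :=
  LinearMap.isometryOfInner
    { toFun := fun a => ((he.memL2 i).mul_const a).toLp
      map_add' := fun a b => by
        refine SliceL2.toLp_eq_of_ae _ ?_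
        filter_upwards [
          Lp.coeFn_add ((he.memL2 i).mul_const a).toLp ((he.memL2 i).mul_const b).toLp,
          ((he.memL2 i).mul_const a).coeFn_toLp, ((he.memL2 i).mul_const b).coeFn_toLp]
          with z h1 h2 h3
        rw [h1, Pi.add_apply, h2, h3, mul_add]
      map_smul' := fun r a => by
        refine SliceL2.toLp_eq_of_ae _ ?_
        filter_upwards [Lp.coeFn_smul r ((he.memL2 i).mul_const a).toLp,
          ((he.memL2 i).mul_const a).coeFn_toLp] with z h1 h2
        rw [RingHom.id_apply, h1, Pi.smul_apply, h2, mul_smul_comm] }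
    (fun a b => by
      simp only [LinearMap.coe_mk, AddHom.coe_mk]
      rw [he.inner_toLp_mul_const, he.inner_self, one_mul])

theorem term_apply (he : IsSliceOrthonormal I e) (i : ι) (a : ℍ[ℝ]) :
    he.term i a = ((he.memL2 i).mul_const a).toLp := rfl

theorem orthogonalFamily (he : IsSliceOrthonormal I e) :
    OrthogonalFamily ℝ (fun _ : ι => ℍ[ℝ]) he.term := by
  intro i j hij a b
  rw [term_apply, term_apply, he.inner_toLp_mul_const, he.inner_ne i j hij, zero_mul,
    inner_zero_right]

/-- Square summable coefficients as a point of `ℓ²`. -/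
def coeffs (hc : Summable fun i => ‖c i‖ ^ 2) : lp (fun _ : ι => ℍ[ℝ]) 2 :=
  ⟨c, (memℓp_gen_iff (by simp)).2 (by simpa using hc)⟩

@[simp] theorem coeffs_apply (hc : Summable fun i => ‖c i‖ ^ 2) (i : ι) : coeffs hc i = c i := rfl

theorem exists_hasSum (he : IsSliceOrthonormal I e) (hc : Summable fun i => ‖c i‖ ^ 2) :
    ∃ f : ℍ[ℝ] → ℍ[ℝ], ∀ q, HasSum (fun i => e i q * c i) (f q) :=
  ⟨fun q => ∑' i, e i q * c i, fun q => (Summable.of_norm (by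
    simpa only [norm_mul] using he.summable_norm_mul hc q)).hasSum⟩

theorem summable_norm_sq_coeff (x : lp (fun _ : ι => ℍ[ℝ]) 2) : Summable fun i => ‖x i‖ ^ 2 := by
  simpa using (memℓp_gen_iff (by simp)).1 (lp.memℓp x)

/-- Bessel's inequality bounds the coefficients of a square integrable function. -/
theorem summable_norm_sq_sliceInner (he : IsSliceOrthonormal I e) (hf : SliceL2 I f) :
    Summable fun i => ‖sliceInner I (e i) f‖ ^ 2 := by
  refine summable_of_sum_le (c := ‖hf.toLp‖ ^ 2) (fun i => by positivity) fun s => ?_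
  set a : ι → ℍ[ℝ] := fun i => sliceInner I (e i) f
  set x := ∑ i ∈ s, he.term i (a i)
  have h1 : inner ℝ x hf.toLp = ∑ i ∈ s, ‖a i‖ ^ 2 := by
    rw [sum_inner]
    refine Finset.sum_congr rfl fun i _ => ?_
    rw [term_apply, ← (he.memL2 i).inner_sliceInner hf, real_inner_self_eq_norm_sq]
  have h2 : ‖x‖ ^ 2 = ∑ i ∈ s, ‖a i‖ ^ 2 := he.orthogonalFamily.norm_sum a s
  have h3 := real_inner_le_norm x hf.toLp
  change ∑ i ∈ s, ‖a i‖ ^ 2 ≤ _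
  rw [h1, ← h2] at h3
  rw [← h2]
  nlinarith [sq_nonneg (‖x‖ - ‖hf.toLp‖)]

variable [Countable ι]

/-- The pointwise sum of a series with square summable coefficients is also its sum in `L²`,
because a subsequence of the partial sums which converge in `L²` converges almost everywhere. -/
theorem exists_toLp_eq (he : IsSliceOrthonormal I e)
    (hc : Summable fun i => ‖c i‖ ^ 2) (hf : ∀ q, HasSum (fun i => e i q * c i) (f q)) :
    ∃ h : SliceL2 I f, h.toLp = he.orthogonalFamily.linearIsometry (coeffs hc) := by
  have hG := he.orthogonalFamily.hasSum_linearIsometry (coeffs hc)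
  set G := he.orthogonalFamily.linearIsometry (coeffs hc)
  obtain ⟨ns, hns, hae⟩ := (tendstoInMeasure_of_tendsto_Lp hG).exists_seq_tendsto_ae'
  have hterm : ∀ᵐ z ∂gaussMeasure, ∀ i,
      (he.term i (c i) : ℂ → ℍ[ℝ]) z = e i (slice I z) * c i :=
    ae_all_iff.2 fun i => ((he.memL2 i).mul_const (c i)).coeFn_toLp
  have hsum : ∀ᵐ z ∂gaussMeasure, ∀ m,
      ((∑ i ∈ ns m, he.term i (c i) : Lp ℍ[ℝ] 2 gaussMeasure) : ℂ → ℍ[ℝ]) z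
        = ∑ i ∈ ns m, (he.term i (c i) : ℂ → ℍ[ℝ]) z := by
    refine ae_all_iff.2 fun m => ?_
    filter_upwards [Lp.coeFn_finsetSum (ns m) fun i => he.term i (c i)] with z hz
    rw [hz, Finset.sum_apply]
  have hGf : (G : ℂ → ℍ[ℝ]) =ᵐ[gaussMeasure] fun z => f (slice I z) := by
    filter_upwards [hae, hterm, hsum] with z h1 h2 h3
    refine tendsto_nhds_unique h1 ?_
    simp only [coeffs_apply, h3, h2]
    exact (hf (slice I z)).comp hns
  exact ⟨(memLp_congr_ae hGf).1 (Lp.memLp G), SliceL2.toLp_eq_of_ae _ hGf⟩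

theorem sliceL2 (he : IsSliceOrthonormal I e)
    (hc : Summable fun i => ‖c i‖ ^ 2) (hf : ∀ q, HasSum (fun i => e i q * c i) (f q)) :
    SliceL2 I f :=
  (he.exists_toLp_eq hc hf).1

/-- Parseval's formula, for the quaternionic inner product. -/
theorem hasSum_sliceInner (he : IsSliceOrthonormal I e)
    (hc : Summable fun i => ‖c i‖ ^ 2) (hf : ∀ q, HasSum (fun i => e i q * c i) (f q))
    (hd : Summable fun i => ‖d i‖ ^ 2) (hg : ∀ q, HasSum (fun i => e i q * d i) (g q)) :
    HasSum (fun i => star (c i) * d i) (sliceInner I f g) := by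
  have hs : Summable fun i => star (c i) * d i := by
    refine Summable.of_norm_bounded (hc.add hd) fun i => ?_
    rw [norm_mul, Quaternion.norm_star]
    nlinarith [sq_nonneg (‖c i‖ - ‖d i‖), sq_nonneg ‖c i‖, sq_nonneg ‖d i‖]
  have key : sliceInner I f g = ∑' i, star (c i) * d i := by
    refine ext_inner_left ℝ fun u => ?_
    have hcu : Summable fun i => ‖c i * u‖ ^ 2 := by
      simp only [norm_mul, mul_pow]
      exact hc.mul_right _
    have hfu : ∀ q, HasSum (fun i => e i q * (c i * u)) (f q * u) := fun q => by
      simpa only [mul_assoc] using (hf q).mul_right u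
    obtain ⟨h1, h1'⟩ := he.exists_toLp_eq hcu hfu
    obtain ⟨h2, h2'⟩ := he.exists_toLp_eq hd hg
    rw [(he.sliceL2 hc hf).inner_sliceInner h2, h2']
    have h3 := (lp.hasSum_inner (𝕜 := ℝ) (coeffs hcu) (coeffs hd)).tsum_eq
    rw [← (he.orthogonalFamily.linearIsometry).inner_map_map, ← h1'] at h3
    refine Eq.trans h3.symm ?_
    rw [← innerSL_apply_apply ℝ u, ContinuousLinearMap.map_tsum _ hs]
    simp only [coeffs_apply, innerSL_apply_apply, Quaternion.inner_mul_left_eq]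
  rw [key]
  exact hs.hasSum

theorem sliceInner_self (he : IsSliceOrthonormal I e)
    (hc : Summable fun i => ‖c i‖ ^ 2) (hf : ∀ q, HasSum (fun i => e i q * c i) (f q)) :
    sliceInner I f f = ((∑' i, ‖c i‖ ^ 2 : ℝ) : ℍ[ℝ]) := by
  refine (he.hasSum_sliceInner hc hf hc hf).unique ?_
  simp only [Quaternion.star_mul_self_eq_norm_sq]
  exact Quaternion.hasSum_coe.2 hc.hasSum

theorem sliceNorm_eq (he : IsSliceOrthonormal I e)
    (hc : Summable fun i => ‖c i‖ ^ 2) (hf : ∀ q, HasSum (fun i => e i q * c i) (f q)) :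
    sliceNorm I f = ‖coeffs hc‖ := by
  have h := lp.norm_rpow_eq_tsum (p := 2) (by simp) (coeffs hc)
  simp only [ENNReal.toReal_ofNat, Real.rpow_ofNat, coeffs_apply] at h
  rw [sliceNorm, he.sliceInner_self hc hf, Quaternion.re_coe, ← h, Real.sqrt_sq (norm_nonneg _)]

theorem norm_apply_le (he : IsSliceOrthonormal I e)
    (hc : Summable fun i => ‖c i‖ ^ 2) (hf : ∀ q, HasSum (fun i => e i q * c i) (f q)) (p : ℍ[ℝ]) :
    ‖f p‖ ≤ Real.sqrt (∑' i, ‖e i p‖ ^ 2) * sliceNorm I f := by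
  have h := Real.inner_le_Lp_mul_Lq_tsum_of_nonneg (p := 2) (q := 2)
    ⟨by norm_num, by norm_num, by norm_num⟩ (f := fun i => ‖e i p‖) (g := fun i => ‖c i‖)
    (fun i => norm_nonneg _) (fun i => norm_nonneg _) (by simpa using he.summable p)
    (by simpa using hc)
  rw [sliceNorm, he.sliceInner_self hc hf, Quaternion.re_coe, Real.sqrt_eq_rpow, Real.sqrt_eq_rpow,
    ← (hf p).tsum_eq]
  refine (norm_tsum_le_tsum_norm ?_).trans ?_
  · simpa only [norm_mul] using he.summable_norm_mul hc p
  · simpa only [norm_mul, Real.rpow_ofNat] using h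

theorem sliceNorm_sub_eq (he : IsSliceOrthonormal I e)
    (hc : Summable fun i => ‖c i‖ ^ 2) (hf : ∀ q, HasSum (fun i => e i q * c i) (f q))
    (hd : Summable fun i => ‖d i‖ ^ 2) (hg : ∀ q, HasSum (fun i => e i q * d i) (g q)) :
    sliceNorm I (fun q => f q - g q) = ‖coeffs hc - coeffs hd‖ :=
  he.sliceNorm_eq (summable_norm_sq_coeff (coeffs hc - coeffs hd)) fun q => by
    simpa [mul_sub] using (hf q).sub (hg q)

/-- The space is isometric to `ℓ²`, hence complete. -/
theorem isRightHilbert (he : IsSliceOrthonormal I e) : IsRightHilbert I (sliceSpan e) where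
  zero_mem := ⟨0, by simp, fun q => by simp⟩
  add_mem := by
    rintro f ⟨c, hc, hf⟩ g ⟨d, hd, hg⟩
    refine ⟨fun i => c i + d i, summable_norm_sq_coeff (coeffs hc + coeffs hd), fun q => ?_⟩
    simpa only [mul_add] using (hf q).add (hg q)
  mul_mem := by
    rintro f ⟨c, hc, hf⟩ a
    refine ⟨fun i => c i * a, ?_, fun q => ?_⟩
    · simp only [norm_mul, mul_pow]
      exact hc.mul_right _
    · simpa only [mul_assoc] using (hf q).mul_right a
  memL2 := by
    rintro f ⟨c, hc, hf⟩
    exact he.sliceL2 hc hf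
  definite := by
    rintro f ⟨c, hc, hf⟩ h q
    have h0 : sliceNorm I f = 0 := by simp [sliceNorm, h]
    have := he.norm_apply_le hc hf q
    rw [h0, mul_zero] at this
    exact norm_le_zero_iff.1 this
  complete := by
    intro u hu hcauchy
    choose c hc hf using hu
    have hC : CauchySeq fun m => coeffs (hc m) := by
      rw [Metric.cauchySeq_iff]
      intro ε hε
      obtain ⟨N, hN⟩ := hcauchy ε hε
      refine ⟨N, fun m hm l hl => ?_⟩
      rw [dist_eq_norm, ← he.sliceNorm_sub_eq (hc m) (hf m) (hc l) (hf l)]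
      exact hN m hm l hl
    obtain ⟨x, hx⟩ := cauchySeq_tendsto_of_complete hC
    have hx2 := summable_norm_sq_coeff x
    obtain ⟨f, hfx⟩ := he.exists_hasSum hx2
    refine ⟨f, ⟨x, hx2, hfx⟩, fun ε hε => ?_⟩
    obtain ⟨N, hN⟩ := Metric.tendsto_atTop.1 hx ε hε
    refine ⟨N, fun m hm => ?_⟩
    rw [he.sliceNorm_sub_eq (hc m) (hf m) hx2 hfx]
    have := hN m hm
    rwa [dist_eq_norm] at this

/-- The span of an orthonormal family has the reproducing kernel
`K(p, q) = ∑ e_i(q) \overline{e_i(p)}`. -/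
theorem isReproducingKernelSpace (he : IsSliceOrthonormal I e) {K : ℍ[ℝ] → ℍ[ℝ] → ℍ[ℝ]}
    (hK : ∀ p q, HasSum (fun i => e i q * star (e i p)) (K p q)) :
    IsReproducingKernelSpace I (sliceSpan e) K := by
  have hs : ∀ p, Summable fun i => ‖star (e i p)‖ ^ 2 := fun p => by
    simpa only [Quaternion.norm_star] using he.summable p
  refine ⟨he.isRightHilbert, fun p => ⟨Real.sqrt (∑' i, ‖e i p‖ ^ 2), ?_⟩,
    fun p => ⟨_, hs p, hK p⟩, ?_, fun p q => ?_⟩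
  · rintro f ⟨c, hc, hf⟩
    exact he.norm_apply_le hc hf p
  · rintro f ⟨c, hc, hf⟩ p
    refine (hf p).unique ?_
    simpa only [star_star] using he.hasSum_sliceInner (hs p) (hK p) hc hf
  · refine HasSum.unique (f := fun i => e i p * star (e i q)) ?_ (hK q p)
    simpa only [star_mul, star_star] using (hK p q).star

end IsSliceOrthonormal
end Abstract

/-! ### Slices as copies of the complex numbers -/

section Slice

variable {I : ℍ[ℝ]}

theorem norm_of_mem_imagUnits (hI : I ∈ imagUnits) : ‖I‖ = 1 := by
  have h : ‖I‖ ^ 2 = 1 := by rw [← norm_pow, show I ^ 2 = -1 from hI, norm_neg, norm_one]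
  exact (pow_eq_one_iff_of_nonneg (norm_nonneg I) two_ne_zero).1 h

theorem star_of_mem_imagUnits (hI : I ∈ imagUnits) : star I = -I := by
  have h0 : I ≠ 0 := norm_ne_zero_iff.1 (by rw [norm_of_mem_imagUnits hI]; exact one_ne_zero)
  have h1 : -I * I = 1 := by rw [neg_mul, ← sq, show I ^ 2 = -1 from hI, neg_neg]
  refine mul_right_cancel₀ h0 ?_
  rw [h1, Quaternion.star_mul_self_eq_norm_sq, norm_of_mem_imagUnits hI]
  norm_num

/-- The slice `ℂ_I`, as an algebra homomorphism. -/
def sliceHom (hI : I ∈ imagUnits) : ℂ →ₐ[ℝ] ℍ[ℝ] :=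
  Complex.liftAux I (by rw [← sq]; exact hI)

theorem slice_eq_sliceHom (hI : I ∈ imagUnits) (z : ℂ) : slice I z = sliceHom hI z := by
  rw [sliceHom, Complex.liftAux_apply, slice, ← Quaternion.coe_mul_eq_smul, Quaternion.coe_commutes]
  rfl

theorem star_slice (hI : I ∈ imagUnits) (z : ℂ) : star (slice I z) = slice I (star z) := by
  simp only [slice, star_add, star_mul, Quaternion.star_coe, star_of_mem_imagUnits hI,
    Complex.star_def, Complex.conj_re, Complex.conj_im, Quaternion.coe_neg, mul_neg,
    Quaternion.coe_commutes]

theorem norm_slice (hI : I ∈ imagUnits) (z : ℂ) : ‖slice I z‖ = ‖z‖ := by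
  have h : ((‖slice I z‖ ^ 2 : ℝ) : ℍ[ℝ]) = ((‖z‖ ^ 2 : ℝ) : ℍ[ℝ]) := by
    rw [← Quaternion.star_mul_self_eq_norm_sq, star_slice hI, slice_eq_sliceHom hI,
      slice_eq_sliceHom hI, ← map_mul, Complex.star_def, mul_comm, Complex.mul_conj,
      Complex.normSq_eq_norm_sq]
    exact (sliceHom hI).commutes _
  have h' := Quaternion.coe_injective h
  exact (sq_eq_sq₀ (norm_nonneg _) (norm_nonneg _)).1 h'

/-- The slice `ℂ_I`, as a continuous linear map. -/
def sliceL (hI : I ∈ imagUnits) : ℂ →L[ℝ] ℍ[ℝ] :=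
  (sliceHom hI).toLinearMap.toContinuousLinearMap

theorem sliceL_apply (hI : I ∈ imagUnits) (z : ℂ) : sliceL hI z = slice I z :=
  (slice_eq_sliceHom hI z).symm

theorem continuous_slice (hI : I ∈ imagUnits) : Continuous (slice I) :=
  (sliceL hI).continuous.congr (sliceL_apply hI)

end Slice

/-! ### Hermite polynomials -/

/-- The sums `∑_i s^i C(k,i) m(m-1)⋯(m-i+1) x^{m-i} y^{k-i}` satisfy the recursion of
`(y + s ∂_x)^k x^m`. For `m = 0` the truncated subtraction is harmless, as the term has the
coefficient `0`. -/
theorem sum_choose_descFactorial_succ {A : Type*} [Ring A] [Algebra ℝ A] {x y : A}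
    (h : Commute x y) (s : ℝ) (m k : ℕ) :
    ∑ i ∈ Finset.range (k + 1 + 1), (s ^ i * ((k + 1).choose i : ℝ) * (m.descFactorial i : ℝ)) •
        (x ^ (m - i) * y ^ (k + 1 - i))
      = y * ∑ i ∈ Finset.range (k + 1), (s ^ i * (k.choose i : ℝ) * (m.descFactorial i : ℝ)) •
          (x ^ (m - i) * y ^ (k - i))
        + (s * m) • ∑ i ∈ Finset.range (k + 1),
          (s ^ i * (k.choose i : ℝ) * ((m - 1).descFactorial i : ℝ)) •
            (x ^ (m - 1 - i) * y ^ (k - i)) := by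
  have h1 : y * ∑ i ∈ Finset.range (k + 1),
        (s ^ i * (k.choose i : ℝ) * (m.descFactorial i : ℝ)) • (x ^ (m - i) * y ^ (k - i))
      = ∑ i ∈ Finset.range (k + 1 + 1),
        (s ^ i * (k.choose i : ℝ) * (m.descFactorial i : ℝ)) •
          (x ^ (m - i) * y ^ (k + 1 - i)) := by
    rw [Finset.sum_range_succ (n := k + 1), Nat.choose_succ_self]
    simp only [Nat.cast_zero, mul_zero, zero_mul, zero_smul, add_zero]
    rw [Finset.mul_sum]
    refine Finset.sum_congr rfl fun i hi => ?_
    rw [Finset.mem_range, Nat.lt_succ_iff] at hi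
    rw [mul_smul_comm, ← mul_assoc, (h.symm.pow_right _).eq, mul_assoc (x ^ _), ← pow_succ',
      ← Nat.sub_add_comm hi]
  have h2 : (s * m) • ∑ i ∈ Finset.range (k + 1),
        (s ^ i * (k.choose i : ℝ) * ((m - 1).descFactorial i : ℝ)) •
          (x ^ (m - 1 - i) * y ^ (k - i))
      = ∑ i ∈ Finset.range (k + 1),
        (s ^ (i + 1) * (k.choose i : ℝ) * (m.descFactorial (i + 1) : ℝ)) •
          (x ^ (m - (i + 1)) * y ^ (k + 1 - (i + 1))) := by
    rw [Finset.smul_sum]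
    refine Finset.sum_congr rfl fun i _ => ?_
    rw [smul_smul, Nat.add_sub_add_right, Nat.sub_sub, add_comm 1 i]
    congr 1
    rcases m with _ | m
    · simp
    · rw [Nat.succ_descFactorial_succ, Nat.add_sub_cancel]
      push_cast
      ring
  rw [h1, h2, Finset.sum_range_succ', Finset.sum_range_succ' (n := k + 1), add_right_comm,
    ← Finset.sum_add_distrib]
  congr 1
  · refine Finset.sum_congr rfl fun i _ => ?_
    rw [← add_smul, Nat.choose_succ_succ]
    congr 1
    push_cast
    ring
  · simp

theorem hermiteQ_eq_sum (m k : ℕ) (q : ℍ[ℝ]) :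
    hermiteQ m k q = ∑ i ∈ Finset.range (k + 1),
      ((-1 : ℝ) ^ i * (k.choose i : ℝ) * (m.descFactorial i : ℝ)) •
        (q ^ (m - i) * star q ^ (k - i)) := by
  rw [hermiteQ, ← Finset.sum_subset (Finset.range_mono (Nat.succ_le_succ (min_le_right m k)))]
  · refine Finset.sum_congr rfl fun i hi => ?_
    rw [Finset.mem_range, Nat.lt_succ_iff, le_min_iff] at hi
    congr 1
    rw [Nat.cast_choose ℝ hi.2, Nat.descFactorial_eq_div hi.1,
      Nat.cast_div (Nat.factorial_dvd_factorial (Nat.sub_le m i)) (by positivity)]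
    field_simp
  · intro i hi hi'
    have : m < i := by
      rw [Finset.mem_range] at hi hi'
      omega
    rw [Nat.descFactorial_eq_zero_iff_lt.2 this]
    simp

@[simp] theorem hermiteQ_zero_right (m : ℕ) (q : ℍ[ℝ]) : hermiteQ m 0 q = q ^ m := by
  simp [hermiteQ_eq_sum]

/-- The recursion expressing `H_{m,k} = (q̄ - ∂_q)^k q^m`. -/
theorem hermiteQ_succ_right (m k : ℕ) (q : ℍ[ℝ]) :
    hermiteQ m (k + 1) q = star q * hermiteQ m k q - (m : ℝ) • hermiteQ (m - 1) k q := by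
  have hc : Commute q (star q) := star_comm_self.symm
  rw [hermiteQ_eq_sum, hermiteQ_eq_sum, hermiteQ_eq_sum, sum_choose_descFactorial_succ hc, neg_mul,
    one_mul, neg_smul, sub_eq_add_neg]

theorem commute_star_hermiteQ (m k : ℕ) (q : ℍ[ℝ]) : Commute (star q) (hermiteQ m k q) := by
  have hc : Commute (star q) q := star_comm_self
  exact Commute.sum_right _ _ _ fun i _ =>
    ((hc.pow_right _).mul_right ((Commute.refl _).pow_right _)).smul_right _

theorem norm_hermiteQ_le (m k : ℕ) (q : ℍ[ℝ]) :
    ‖hermiteQ m k q‖ ≤ (1 + ‖q‖ + m) ^ k * (1 + ‖q‖) ^ m := by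
  have hq := norm_nonneg q
  induction k generalizing m with
  | zero =>
    rw [hermiteQ_zero_right, norm_pow, pow_zero, one_mul]
    gcongr
    linarith
  | succ k ih =>
    rw [hermiteQ_succ_right]
    refine (norm_sub_le _ _).trans ?_
    rw [norm_mul, norm_smul, Quaternion.norm_star, Real.norm_natCast]
    have h1 : (m : ℝ) * ‖hermiteQ (m - 1) k q‖ ≤ m * ((1 + ‖q‖ + m) ^ k * (1 + ‖q‖) ^ m) := by
      refine mul_le_mul_of_nonneg_left ((ih (m - 1)).trans ?_) (by positivity)
      gcongr
      · exact_mod_cast Nat.sub_le m 1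
      · linarith
      · exact Nat.sub_le m 1
    have h2 : ‖q‖ * ‖hermiteQ m k q‖ ≤ ‖q‖ * ((1 + ‖q‖ + m) ^ k * (1 + ‖q‖) ^ m) :=
      mul_le_mul_of_nonneg_left (ih m) hq
    have h3 : 0 ≤ (1 + ‖q‖ + m) ^ k * (1 + ‖q‖) ^ m := by positivity
    rw [pow_succ' _ k, mul_assoc]
    nlinarith

/-- For fixed `k`, the polynomials `H_{m,k}` grow at most geometrically in `m`. -/
theorem norm_hermiteQ_le_geometric (m k : ℕ) (q : ℍ[ℝ]) :
    ‖hermiteQ m k q‖ ≤ k ! * Real.exp (1 + ‖q‖) * (Real.exp 1 * (1 + ‖q‖)) ^ m := by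
  have hq := norm_nonneg q
  refine (norm_hermiteQ_le m k q).trans ?_
  have h := Real.pow_div_factorial_le_exp (1 + ‖q‖ + m) (by positivity) k
  rw [div_le_iff₀ (by positivity)] at h
  rw [mul_pow, ← mul_assoc, ← Real.exp_nat_mul, mul_one, mul_assoc (k ! : ℝ), ← Real.exp_add,
    mul_comm (k ! : ℝ)]
  gcongr

/-- The complex Hermite polynomials, defined by recursion. -/
def hermiteC (z : ℂ) : ℕ → ℕ → ℂ
  | m, 0 => z ^ m
  | m, k + 1 => star z * hermiteC z m k - m * hermiteC z (m - 1) k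

theorem hermiteQ_slice {I : ℍ[ℝ]} (hI : I ∈ imagUnits) (m k : ℕ) (z : ℂ) :
    hermiteQ m k (slice I z) = slice I (hermiteC z m k) := by
  induction k generalizing m with
  | zero => simp [hermiteC, slice_eq_sliceHom hI]
  | succ k ih =>
    have h : slice I (m : ℂ) = (m : ℍ[ℝ]) := by rw [slice_eq_sliceHom hI, map_natCast]
    rw [hermiteQ_succ_right, hermiteC, ih, ih, star_slice hI, slice_eq_sliceHom hI (_ - _), map_sub,
      map_mul, map_mul]
    simp only [← slice_eq_sliceHom hI, h]
    congr 1
    rw [← Quaternion.coe_mul_eq_smul, Quaternion.coe_natCast]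

theorem continuous_hermiteC (m k : ℕ) : Continuous fun z => hermiteC z m k := by
  induction k generalizing m with
  | zero => exact continuous_pow m
  | succ k ih => exact (continuous_star.mul (ih m)).sub (continuous_const.mul (ih (m - 1)))

theorem continuous_hermiteQ (m k : ℕ) : Continuous (hermiteQ m k) := by
  unfold hermiteQ
  fun_prop

theorem norm_hermiteC_le (z : ℂ) (m k : ℕ) :
    ‖hermiteC z m k‖ ≤ (1 + m) ^ k * (1 + ‖z‖) ^ (k + m) := by
  obtain ⟨I, hI⟩ : imagUnits.Nonempty := ⟨Quaternion.ofComplex Complex.I, by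
    change _ ^ 2 = _
    rw [← map_pow, Complex.I_sq, map_neg, map_one]⟩
  rw [← norm_slice hI, ← hermiteQ_slice hI]
  refine (norm_hermiteQ_le m k _).trans ?_
  rw [norm_slice hI, pow_add, ← mul_assoc, ← mul_pow]
  have := norm_nonneg z
  gcongr
  nlinarith [mul_nonneg (Nat.cast_nonneg (α := ℝ) m) this]

/-- `H_{m,k}` is homogeneous of degree `m - k` under rotations. -/
theorem hermiteC_mul {u : ℂ} (hu : ‖u‖ = 1) (z : ℂ) (m k : ℕ) :
    hermiteC (u * z) m k = u ^ m * star u ^ k * hermiteC z m k := by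
  have hu' : u * star u = 1 := by
    rw [Complex.star_def, Complex.mul_conj, Complex.normSq_eq_norm_sq, hu]; norm_num
  induction k generalizing m with
  | zero => simp [hermiteC, mul_pow]
  | succ k ih =>
    rw [hermiteC, hermiteC, ih, ih, star_mul]
    rcases m with _ | m
    · simp; ring
    · rw [Nat.add_sub_cancel]
      have h : u ^ (m + 1) * star u ^ (k + 1) = u ^ m * star u ^ k := by
        rw [pow_succ, pow_succ, mul_mul_mul_comm, hu', mul_one]
      rw [mul_sub, h]
      congr 1
      · linear_combination (star z * star u ^ k * u ^ m * hermiteC z (m + 1) k) * hu'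
      · ring

/-! ### Gaussian integrals -/

theorem integral_gaussMeasure {E : Type*} [NormedAddCommGroup E] [NormedSpace ℝ E] (F : ℂ → E) :
    ∫ z, F z ∂gaussMeasure = ∫ z, Real.exp (-‖z‖ ^ 2) • F z := by
  rw [gaussMeasure, integral_withDensity_eq_integral_toReal_smul (by fun_prop) (by simp)]
  simp only [ENNReal.toReal_ofReal (Real.exp_nonneg _)]

theorem integral_norm_pow_gaussMeasure (n : ℕ) :
    ∫ z, ‖z‖ ^ n ∂gaussMeasure = Real.pi * Real.Gamma ((n + 2) / 2) := by
  have h := Complex.integral_rpow_mul_exp_neg_rpow (p := 2) (q := n) (by norm_num)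
    (by linarith [n.cast_nonneg (α := ℝ)])
  simp only [Real.rpow_ofNat, Real.rpow_natCast] at h
  rw [integral_gaussMeasure]
  simp only [smul_eq_mul, mul_comm (Real.exp _)]
  rw [h]
  ring

theorem integrable_norm_pow_gaussMeasure (n : ℕ) : Integrable (fun z => ‖z‖ ^ n) gaussMeasure := by
  -- a function with nonzero Bochner integral is integrable
  refine not_imp_comm.1 integral_undef ?_
  rw [integral_norm_pow_gaussMeasure]
  have := Real.Gamma_pos_of_pos (s := ((n + 2) / 2 : ℝ)) (by positivity)
  positivity

theorem integrable_gaussMeasure_of_norm_le {E : Type*} [NormedAddCommGroup E] [NormedSpace ℝ E]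
    {F : ℂ → E} (hF : Continuous F) (C : ℝ) (n : ℕ) (h : ∀ z, ‖F z‖ ≤ C * (1 + ‖z‖) ^ n) :
    Integrable F gaussMeasure := by
  have h1 : Integrable (fun z : ℂ => C * (1 + ‖z‖) ^ n) gaussMeasure := by
    refine Integrable.const_mul ?_ C
    have : Integrable (fun z : ℂ => (2 : ℝ) ^ (n - 1) * (1 ^ n + ‖z‖ ^ n)) gaussMeasure := by
      have h0 := integrable_norm_pow_gaussMeasure 0
      simp only [pow_zero] at h0
      simp only [one_pow]
      exact (h0.add (integrable_norm_pow_gaussMeasure n)).const_mul _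
    refine this.mono' (by fun_prop) (.of_forall fun z => ?_)
    rw [Real.norm_of_nonneg (by positivity)]
    exact add_pow_le zero_le_one (norm_nonneg z) n
  exact h1.mono' hF.aestronglyMeasurable (.of_forall h)

instance : IsFiniteMeasure gaussMeasure := by
  have h := integrable_norm_pow_gaussMeasure 0
  simp only [pow_zero] at h
  exact (integrable_const_iff_isFiniteMeasure one_ne_zero).1 h

/-- Rotation invariance kills the integral of a function of nonzero degree. -/
theorem integral_gaussMeasure_eq_zero {F : ℂ → ℂ} {u c : ℂ} (hu : ‖u‖ = 1)
    (hF : ∀ z, F (u * z) = c * F z) (hc : c ≠ 1) : ∫ z, F z ∂gaussMeasure = 0 := by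
  let v : Circle := ⟨u, by simpa [Submonoid.unitSphere] using hu⟩
  have h1 := (rotation v).measurePreserving.integral_comp
    (rotation v).toHomeomorph.measurableEmbedding (fun z => Real.exp (-‖z‖ ^ 2) • F z)
  have h2 : ∀ z, rotation v z = u * z := fun z => rfl
  simp only [h2, norm_mul, hu, one_mul, hF, ← integral_gaussMeasure] at h1
  rw [integral_const_mul] at h1
  by_contra h
  exact hc (mul_right_cancel₀ h (h1.trans (one_mul _).symm))

/-- A nontrivial character of the circle is not constant. -/
theorem exists_norm_eq_one_pow_mul_star_pow_ne_one {a b : ℕ} (hab : a ≠ b) :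
    ∃ u : ℂ, ‖u‖ = 1 ∧ u ^ a * star u ^ b ≠ 1 := by
  -- `u` is chosen such that `u ^ (a - b) = exp (π i) = -1`
  refine ⟨Complex.exp ((Real.pi / (a - b) : ℝ) * Complex.I), Complex.norm_exp_ofReal_mul_I _, ?_⟩
  have h : ((a : ℂ) - b) ≠ 0 := sub_ne_zero.2 (by exact_mod_cast hab)
  rw [Complex.star_def, ← Complex.exp_conj, ← Complex.exp_nat_mul, ← Complex.exp_nat_mul,
    ← Complex.exp_add, map_mul, Complex.conj_I, Complex.conj_ofReal]
  have : (a : ℂ) * ((Real.pi / (a - b) : ℝ) * Complex.I)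
      + b * ((Real.pi / (a - b) : ℝ) * -Complex.I) = Real.pi * Complex.I := by
    push_cast
    field_simp
    ring
  rw [this, Complex.exp_pi_mul_I]
  norm_num

theorem integral_pow_mul_star_pow (a b : ℕ) :
    ∫ z, z ^ a * star z ^ b ∂gaussMeasure = if a = b then (Real.pi * a ! : ℂ) else 0 := by
  split_ifs with h
  · subst h
    have h1 : ∀ z : ℂ, z ^ a * star z ^ a = ((‖z‖ ^ (2 * a) : ℝ) : ℂ) := fun z => by
      rw [← mul_pow, Complex.star_def, Complex.mul_conj, Complex.normSq_eq_norm_sq, pow_mul]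
      norm_cast
    simp only [h1]
    rw [integral_complex_ofReal, integral_norm_pow_gaussMeasure]
    have : (((2 * a : ℕ) : ℝ) + 2) / 2 = a + 1 := by push_cast; ring
    rw [this, Real.Gamma_nat_eq_factorial]
    push_cast
    ring
  · obtain ⟨u, hu, hne⟩ := exists_norm_eq_one_pow_mul_star_pow_ne_one h
    exact integral_gaussMeasure_eq_zero hu (fun z => by rw [star_mul]; ring) hne

theorem integrable_hermiteC_mul (m k m' k' a b : ℕ) :
    Integrable (fun z => star (hermiteC z m k) * hermiteC z m' k' * z ^ a * star z ^ b)
      gaussMeasure := by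
  have h1 := continuous_hermiteC m k
  have h2 := continuous_hermiteC m' k'
  refine integrable_gaussMeasure_of_norm_le (by fun_prop)
    ((1 + m) ^ k * (1 + m') ^ k') (k + m + (k' + m') + a + b) fun z => ?_
  have h3 := norm_nonneg z
  have h4 : ‖z‖ ≤ 1 + ‖z‖ := by linarith
  simp only [norm_mul, norm_pow, norm_star]
  calc _ ≤ ((1 + m) ^ k * (1 + ‖z‖) ^ (k + m)) * ((1 + m') ^ k' * (1 + ‖z‖) ^ (k' + m'))
        * (1 + ‖z‖) ^ a * (1 + ‖z‖) ^ b := by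
        gcongr
        · exact norm_hermiteC_le z m k
        · exact norm_hermiteC_le z m' k'
    _ = _ := by ring

/-- Integration by parts: `∫ \overline{H_{m,k}} z^a z̄^b` is the integral of
`z̄^m ∂_z̄^k (z^a z̄^b)`. -/
theorem integral_star_hermiteC_mul_pow (m k a b : ℕ) :
    ∫ z, star (hermiteC z m k) * z ^ a * star z ^ b ∂gaussMeasure
      = if a + k = b + m then (Real.pi * a ! * b.descFactorial k : ℂ) else 0 := by
  induction k generalizing m a with
  | zero =>
    have : ∀ z : ℂ, star (hermiteC z m 0) * z ^ a * star z ^ b = z ^ a * star z ^ (b + m) :=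
      fun z => by
        rw [hermiteC, star_pow]
        ring
    simp only [this, integral_pow_mul_star_pow]
    simp
  | succ k ih =>
    have h0 : ∀ (m a : ℕ),
        Integrable (fun z => star (hermiteC z m k) * z ^ a * star z ^ b) gaussMeasure :=
      fun m a => by simpa [hermiteC] using integrable_hermiteC_mul m k 0 0 a b
    have : ∀ z : ℂ, star (hermiteC z m (k + 1)) * z ^ a * star z ^ b
        = star (hermiteC z m k) * z ^ (a + 1) * star z ^ b
          - m * (star (hermiteC z (m - 1) k) * z ^ a * star z ^ b) := fun z => by
      rw [hermiteC, star_sub, star_mul, star_mul, star_star, star_natCast]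
      ring
    simp only [this]
    rw [integral_sub (h0 _ _) ((h0 _ _).const_mul _), integral_const_mul, ih, ih,
      Nat.descFactorial_succ]
    by_cases h : a + 1 + k = b + m
    · rw [if_pos h, if_pos (by omega : a + (k + 1) = b + m)]
      rcases lt_or_ge b k with hb | hb
      · simp [Nat.descFactorial_eq_zero_iff_lt.2 hb]
      · rw [Nat.cast_mul, Nat.cast_sub hb, Nat.factorial_succ]
        have hab : (a : ℂ) + 1 + k = b + m := by exact_mod_cast h
        rcases m with _ | m
        · simp only [Nat.cast_zero, add_zero] at hab
          push_cast
          rw [← hab]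
          ring
        · rw [if_pos (by omega : a + k = b + (m + 1 - 1))]
          push_cast at hab ⊢
          linear_combination (Real.pi * a ! * b.descFactorial k : ℂ) * hab
    · rw [if_neg h, if_neg (by omega : ¬a + (k + 1) = b + m)]
      rcases m with _ | m
      · simp
      · rw [if_neg (by omega : ¬a + k = b + (m + 1 - 1))]
        simp

/-- As `H_{m,k}` is orthogonal to the monomials of degree less than `k` in `z̄`, only the leading
term of `z̄^b H_{m',k'}` contributes. -/
theorem integral_star_hermiteC_mul_hermiteC_of_le (m k m' k' b : ℕ) (hb : k' + b ≤ k) :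
    ∫ z, star (hermiteC z m k) * hermiteC z m' k' * star z ^ b ∂gaussMeasure
      = if k' + b = k ∧ m' = m then (Real.pi * m ! * k ! : ℂ) else 0 := by
  induction k' generalizing m' b with
  | zero =>
    simp only [hermiteC, integral_star_hermiteC_mul_pow]
    rw [zero_add] at hb ⊢
    rcases hb.lt_or_eq with hb | rfl
    · rw [Nat.descFactorial_eq_zero_iff_lt.2 hb, if_neg (by omega : ¬(b = k ∧ m' = m))]
      simp
    · by_cases h : m' = m
      · subst h
        simp [add_comm, Nat.descFactorial_self]
      · rw [if_neg (by omega), if_neg (by omega)]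
  | succ k' ih =>
    have h0 : ∀ (m' b : ℕ),
        Integrable (fun z => star (hermiteC z m k) * hermiteC z m' k' * star z ^ b) gaussMeasure :=
      fun m' b => by simpa using integrable_hermiteC_mul m k m' k' 0 b
    have : ∀ z : ℂ, star (hermiteC z m k) * hermiteC z m' (k' + 1) * star z ^ b
        = star (hermiteC z m k) * hermiteC z m' k' * star z ^ (b + 1)
          - m' * (star (hermiteC z m k) * hermiteC z (m' - 1) k' * star z ^ b) := fun z => by
      rw [hermiteC]
      ring
    simp only [this]
    rw [integral_sub (h0 _ _) ((h0 _ _).const_mul _), integral_const_mul, ih _ _ (by omega),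
      ih _ _ (by omega), if_neg (by omega : ¬(k' + b = k ∧ m' - 1 = m)), mul_zero, sub_zero,
      add_right_comm, add_assoc]

/-- The Hermite polynomials are orthogonal. -/
theorem integral_star_hermiteC_mul_hermiteC (m k m' k' : ℕ) :
    ∫ z, star (hermiteC z m k) * hermiteC z m' k' ∂gaussMeasure
      = if k' = k ∧ m' = m then (Real.pi * m ! * k ! : ℂ) else 0 := by
  rcases le_total k' k with h | h
  · simpa using integral_star_hermiteC_mul_hermiteC_of_le m k m' k' 0 h
  · have h1 := integral_star_hermiteC_mul_hermiteC_of_le m' k' m k 0 h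
    simp only [pow_zero, mul_one, add_zero] at h1
    have h2 : ∀ z : ℂ, star (hermiteC z m k) * hermiteC z m' k'
        = (starRingEnd ℂ) (star (hermiteC z m' k') * hermiteC z m k) := fun z => by
      rw [← Complex.star_def, star_mul, star_star]
    simp only [h2]
    rw [integral_conj, h1]
    by_cases h3 : k' = k ∧ m' = m
    · obtain ⟨rfl, rfl⟩ := h3
      simp
    · rw [if_neg h3, if_neg (fun h4 => h3 ⟨h4.1.symm, h4.2.symm⟩), map_zero]

/-! ### The orthonormal family of normalized Hermite polynomials -/

/-- The Hermite polynomial `H_{m,k}` divided by its norm `√(π m! k!)`. -/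
def hermiteUnit (k m : ℕ) (q : ℍ[ℝ]) : ℍ[ℝ] :=
  (Real.sqrt (Real.pi * m ! * k !))⁻¹ • hermiteQ m k q

theorem sqrt_weight_pos (m k : ℕ) : 0 < Real.sqrt (Real.pi * m ! * k !) :=
  Real.sqrt_pos.2 (by positivity)

theorem sliceL2_hermiteQ {I : ℍ[ℝ]} (hI : I ∈ imagUnits) (m k : ℕ) : SliceL2 I (hermiteQ m k) := by
  have hcont : Continuous fun z => hermiteQ m k (slice I z) :=
    (continuous_hermiteQ m k).comp (continuous_slice hI)
  refine (memLp_two_iff_integrable_sq_norm hcont.aestronglyMeasurable).2 ?_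
  refine integrable_gaussMeasure_of_norm_le (by fun_prop) (((1 + m) ^ k) ^ 2) (2 * (k + m))
    fun z => ?_
  rw [hermiteQ_slice hI, norm_slice hI, Real.norm_of_nonneg (by positivity), mul_comm 2, pow_mul,
    ← mul_pow]
  gcongr
  exact norm_hermiteC_le z m k

theorem star_hermiteQ_mul_slice {I : ℍ[ℝ]} (hI : I ∈ imagUnits) (m k m' k' : ℕ) (z : ℂ) :
    star (hermiteQ m k (slice I z)) * hermiteQ m' k' (slice I z)
      = sliceL hI (star (hermiteC z m k) * hermiteC z m' k') := by
  rw [hermiteQ_slice hI, hermiteQ_slice hI, star_slice hI, sliceL_apply]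
  simp only [slice_eq_sliceHom hI, map_mul]

theorem sliceInner_hermiteQ {I : ℍ[ℝ]} (hI : I ∈ imagUnits) (m k m' k' : ℕ) :
    sliceInner I (hermiteQ m k) (hermiteQ m' k')
      = if k' = k ∧ m' = m then ((Real.pi * m ! * k ! : ℝ) : ℍ[ℝ]) else 0 := by
  unfold sliceInner
  simp only [star_hermiteQ_mul_slice hI]
  rw [ContinuousLinearMap.integral_comp_comm, integral_star_hermiteC_mul_hermiteC]
  · split_ifs
    · have : (Real.pi * m ! * k ! : ℂ) = ((Real.pi * m ! * k ! : ℝ) : ℂ) := by push_cast; rfl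
      rw [sliceL_apply, slice_eq_sliceHom hI, this]
      exact (sliceHom hI).commutes _
    · exact map_zero _
  · simpa using integrable_hermiteC_mul m k m' k' 0 0

theorem sliceInner_smul_smul (I : ℍ[ℝ]) (f g : ℍ[ℝ] → ℍ[ℝ]) (r s : ℝ) :
    sliceInner I (fun q => r • f q) (fun q => s • g q) = (r * s) • sliceInner I f g := by
  unfold sliceInner
  rw [← integral_smul]
  simp only [Quaternion.star_smul, smul_mul_smul_comm]

theorem sliceInner_hermiteUnit {I : ℍ[ℝ]} (hI : I ∈ imagUnits) (k m k' m' : ℕ) :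
    sliceInner I (hermiteUnit k m) (hermiteUnit k' m') = if k' = k ∧ m' = m then 1 else 0 := by
  unfold hermiteUnit
  rw [sliceInner_smul_smul, sliceInner_hermiteQ hI]
  split_ifs with h
  · obtain ⟨rfl, rfl⟩ := h
    rw [← mul_inv, Real.mul_self_sqrt (by positivity), ← Quaternion.coe_smul, smul_eq_mul,
      inv_mul_cancel₀ (by positivity), Quaternion.coe_one]
  · exact smul_zero _

theorem summable_norm_hermiteUnit_sq (k : ℕ) (q : ℍ[ℝ]) :
    Summable fun m => ‖hermiteUnit k m q‖ ^ 2 := by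
  refine Summable.of_nonneg_of_le (fun m => by positivity) (fun m => ?_)
    ((Real.summable_pow_div_factorial ((Real.exp 1 * (1 + ‖q‖)) ^ 2)).mul_left
      ((k ! * Real.exp (1 + ‖q‖)) ^ 2 / (Real.pi * k !)))
  rw [hermiteUnit, norm_smul, norm_inv, Real.norm_of_nonneg (Real.sqrt_nonneg _), mul_pow, inv_pow,
    Real.sq_sqrt (by positivity)]
  calc _ ≤ (Real.pi * m ! * k !)⁻¹
        * (k ! * Real.exp (1 + ‖q‖) * (Real.exp 1 * (1 + ‖q‖)) ^ m) ^ 2 := by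
        gcongr
        exact norm_hermiteQ_le_geometric m k q
    _ = _ := by
        rw [mul_pow, ← pow_mul, ← pow_mul, mul_comm m 2]
        field_simp

theorem sliceL2_hermiteUnit {I : ℍ[ℝ]} (hI : I ∈ imagUnits) (k m : ℕ) :
    SliceL2 I (hermiteUnit k m) :=
  MemLp.const_smul (f := fun z => hermiteQ m k (slice I z)) (sliceL2_hermiteQ hI m k)
    (Real.sqrt (Real.pi * m ! * k !))⁻¹

theorem isSliceOrthonormal_hermiteUnit {I : ℍ[ℝ]} (hI : I ∈ imagUnits) (k : ℕ) :
    IsSliceOrthonormal I (hermiteUnit k) where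
  memL2 m := sliceL2_hermiteUnit hI k m
  inner_self m := by rw [sliceInner_hermiteUnit hI, if_pos ⟨rfl, rfl⟩]
  inner_ne m m' h := by rw [sliceInner_hermiteUnit hI, if_neg (by omega)]
  summable := summable_norm_hermiteUnit_sq k

theorem isSliceOrthonormal_hermiteUnit_fin {I : ℍ[ℝ]} (hI : I ∈ imagUnits) (n : ℕ) :
    IsSliceOrthonormal I (fun i : Fin (n + 1) × ℕ => hermiteUnit i.1 i.2) where
  memL2 i := sliceL2_hermiteUnit hI i.1 i.2
  inner_self i := by rw [sliceInner_hermiteUnit hI, if_pos ⟨rfl, rfl⟩]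
  inner_ne i j h := by
    rw [sliceInner_hermiteUnit hI, if_neg]
    rintro ⟨h1, h2⟩
    exact h (Prod.ext (Fin.ext h1.symm) h2.symm)
  summable q := by
    rw [summable_prod_of_nonneg (fun _ => by positivity)]
    exact ⟨fun k => summable_norm_hermiteUnit_sq k q, Summable.of_finite⟩

/-! ### The operator `q̄ - ∂_q` on formal series -/

/-- The formal derivative of a power series with quaternionic coefficients. -/
def psDeriv : PowerSeries ℍ[ℝ] →ₗ[ℝ] PowerSeries ℍ[ℝ] where
  toFun f := PowerSeries.mk fun j => ((j : ℝ) + 1) • PowerSeries.coeff (j + 1) f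
  map_add' f g := by
    ext1 j
    simp
  map_smul' r f := by
    ext1 j
    simp [smul_comm r]

theorem coeff_psDeriv (f : PowerSeries ℍ[ℝ]) (j : ℕ) :
    PowerSeries.coeff j (psDeriv f) = ((j : ℝ) + 1) • PowerSeries.coeff (j + 1) f :=
  PowerSeries.coeff_mk j fun j => ((j : ℝ) + 1) • PowerSeries.coeff (j + 1) f

theorem psDeriv_X_mul (f : PowerSeries ℍ[ℝ]) :
    psDeriv (PowerSeries.X * f) = f + PowerSeries.X * psDeriv f := by
  ext1 j
  rw [coeff_psDeriv, PowerSeries.coeff_succ_X_mul, map_add]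
  rcases j with _ | j
  · simp
  · rw [PowerSeries.coeff_succ_X_mul, coeff_psDeriv]
    push_cast
    module

theorem psDeriv_C_mul (a : ℍ[ℝ]) (f : PowerSeries ℍ[ℝ]) :
    psDeriv (PowerSeries.C a * f) = PowerSeries.C a * psDeriv f := by
  ext1 j
  simp only [coeff_psDeriv, PowerSeries.coeff_C_mul, mul_smul_comm]

/-- The derivative `∂_q` of formal series in `q`, `q̄`, the variable `q̄` being held constant. -/
def spDeriv : SPSeries →ₗ[ℝ] SPSeries :=
  Polynomial.lsum fun k => ((Polynomial.monomial k).restrictScalars ℝ).comp psDeriv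

@[simp] theorem coeff_spDeriv (F : SPSeries) (k : ℕ) :
    (spDeriv F).coeff k = psDeriv (F.coeff k) := by
  induction F using Polynomial.induction_on' with
  | add F G hF hG => simp [hF, hG]
  | monomial n f =>
    rw [spDeriv, Polynomial.lsum_apply, Polynomial.sum_monomial_index (hf := by simp)]
    simp only [LinearMap.comp_apply, LinearMap.restrictScalars_apply, Polynomial.coeff_monomial]
    split_ifs <;> simp

theorem spDeriv_spVarConj_mul (F : SPSeries) :
    spDeriv (spVarConj * F) = spVarConj * spDeriv F := by
  ext1 k
  rw [coeff_spDeriv, spVarConj]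
  rcases k with _ | k
  · simp
  · simp [Polynomial.coeff_X_mul]

theorem spDeriv_spVar_mul (F : SPSeries) : spDeriv (spVar * F) = F + spVar * spDeriv F := by
  ext1 k
  simp only [coeff_spDeriv, spVar, Polynomial.coeff_C_mul, Polynomial.coeff_add, psDeriv_X_mul]

theorem spDeriv_spConst_mul (a : ℍ[ℝ]) (F : SPSeries) :
    spDeriv (spConst a * F) = spConst a * spDeriv F := by
  ext1 k
  simp only [coeff_spDeriv, spConst, Polynomial.coeff_C_mul, psDeriv_C_mul]

theorem spDeriv_C (f : PowerSeries ℍ[ℝ]) :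
    spDeriv (Polynomial.C f) = Polynomial.C (psDeriv f) := by
  ext1 k
  rw [coeff_spDeriv, Polynomial.coeff_C, Polynomial.coeff_C]
  split_ifs <;> simp

theorem spDeriv_starExp (b : ℍ[ℝ]) : spDeriv (starExp b) = spConst b * starExp b := by
  rw [starExp, spDeriv_C, spConst, ← Polynomial.C_mul]
  congr 1
  ext1 j
  rw [coeff_psDeriv, PowerSeries.coeff_C_mul, PowerSeries.coeff_mk, PowerSeries.coeff_mk,
    smul_smul, mul_smul_comm, ← pow_succ', Nat.factorial_succ]
  congr 1
  push_cast
  field_simp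

/-- The operator `q̄ - ∂_q`, which raises the second index of the Hermite polynomials. -/
def raise : SPSeries →ₗ[ℝ] SPSeries := LinearMap.mulLeft ℝ spVarConj - spDeriv

theorem raise_apply (F : SPSeries) : raise F = spVarConj * F - spDeriv F := rfl

theorem spVarConj_mul (F : SPSeries) : spVarConj * F = F * spVarConj :=
  (Polynomial.commute_X F).eq

theorem spVar_mul (F : SPSeries) : spVar * F = F * spVar := by
  ext1 k
  rw [spVar, Polynomial.coeff_C_mul, Polynomial.coeff_mul_C, PowerSeries.X_mul]

theorem raise_spVarConj_mul (F : SPSeries) : raise (spVarConj * F) = spVarConj * raise F := by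
  simp only [raise_apply, spDeriv_spVarConj_mul, mul_sub]

theorem raise_pow_spVarConj_mul (k : ℕ) (F : SPSeries) :
    (raise ^ k) (spVarConj * F) = spVarConj * (raise ^ k) F := by
  induction k generalizing F with
  | zero => simp
  | succ k ih => rw [pow_succ, Module.End.mul_apply, Module.End.mul_apply, raise_spVarConj_mul, ih]

theorem raise_spConst_mul (a : ℍ[ℝ]) (F : SPSeries) :
    raise (spConst a * F) = spConst a * raise F := by
  simp only [raise_apply, spDeriv_spConst_mul, mul_sub, ← mul_assoc, spVarConj_mul (spConst a)]

/-- The factor `p - q` of `-|q - p|²_⋆`. -/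
def distVar (p : ℍ[ℝ]) : SPSeries := spConst p - spVar

/-- The factor `q̄ - p̄` of `|q - p|²_⋆`. -/
def distVarConj (p : ℍ[ℝ]) : SPSeries := spVarConj - spConst (star p)

theorem spConst_mul (a b : ℍ[ℝ]) : spConst (a * b) = spConst a * spConst b := by
  simp [spConst]

theorem commute_spConst_star (p : ℍ[ℝ]) : Commute (spConst p) (spConst (star p)) := by
  rw [Commute, SemiconjBy, ← spConst_mul, ← spConst_mul, star_comm_self']

theorem commute_spConst_starExp {a b : ℍ[ℝ]} (h : Commute a b) :
    Commute (spConst a) (starExp b) := by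
  rw [Commute, SemiconjBy, spConst, starExp, ← Polynomial.C_mul, ← Polynomial.C_mul]
  congr 1
  ext1 j
  rw [PowerSeries.coeff_C_mul, PowerSeries.coeff_mul_C, PowerSeries.coeff_mk, mul_smul_comm,
    smul_mul_assoc, (h.pow_right j).eq]

theorem commute_distVar_distVarConj (p : ℍ[ℝ]) : Commute (distVar p) (distVarConj p) :=
  Commute.sub_left
    (Commute.sub_right (spVarConj_mul _).symm (commute_spConst_star p))
    (Commute.sub_right (spVarConj_mul _).symm (spVar_mul _))

theorem commute_distVar_starExp (p : ℍ[ℝ]) : Commute (distVar p) (starExp (star p)) :=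
  (commute_spConst_starExp star_comm_self.symm).sub_left (spVar_mul _)

theorem commute_distVarConj_starExp (p : ℍ[ℝ]) : Commute (distVarConj p) (starExp (star p)) :=
  Commute.sub_left (spVarConj_mul _) (commute_spConst_starExp (Commute.refl _))

theorem starDistSq_eq (p : ℍ[ℝ]) : starDistSq p = -(distVar p * distVarConj p) := by
  rw [starDistSq, distVar, distVarConj, ← neg_mul (spConst p - spVar), neg_sub]

/-- The commutation relation `[q̄ - ∂_q, p - q] = 1`. -/
theorem raise_distVar_mul (p : ℍ[ℝ]) (F : SPSeries) :
    raise (distVar p * F) = distVar p * raise F + F := by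
  have h : raise (spVar * F) = spVar * raise F - F := by
    simp only [raise_apply, spDeriv_spVar_mul, mul_sub, ← mul_assoc, spVarConj_mul spVar]
    abel
  rw [distVar, sub_mul, map_sub, raise_spConst_mul, h, sub_mul, sub_sub_eq_add_sub,
    add_sub_right_comm]

theorem raise_distVarConj_mul (p : ℍ[ℝ]) (F : SPSeries) :
    raise (distVarConj p * F) = distVarConj p * raise F := by
  rw [distVarConj, sub_mul, map_sub, raise_spVarConj_mul, raise_spConst_mul, sub_mul]

theorem raise_pow_distVarConj_mul (k : ℕ) (p : ℍ[ℝ]) (F : SPSeries) :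
    (raise ^ k) (distVarConj p * F) = distVarConj p * (raise ^ k) F := by
  induction k generalizing F with
  | zero => simp
  | succ k ih =>
    rw [pow_succ, Module.End.mul_apply, Module.End.mul_apply, raise_distVarConj_mul, ih]

theorem raise_starExp (p : ℍ[ℝ]) :
    raise (starExp (star p)) = distVarConj p * starExp (star p) := by
  rw [raise_apply, spDeriv_starExp, distVarConj, sub_mul]

theorem raise_distVar_pow_mul_starExp (p : ℍ[ℝ]) (m : ℕ) :
    raise (distVar p ^ m * starExp (star p))
      = distVarConj p * (distVar p ^ m * starExp (star p))
        + (m : ℝ) • (distVar p ^ (m - 1) * starExp (star p)) := by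
  induction m with
  | zero => simp [raise_starExp]
  | succ m ih =>
    have h1 : distVar p * (distVarConj p * (distVar p ^ m * starExp (star p)))
        = distVarConj p * (distVar p ^ (m + 1) * starExp (star p)) := by
      rw [← mul_assoc, (commute_distVar_distVarConj p).eq, mul_assoc, ← mul_assoc (distVar p),
        ← pow_succ']
    have h2 : (m : ℝ) • (distVar p * (distVar p ^ (m - 1) * starExp (star p)))
        = (m : ℝ) • (distVar p ^ m * starExp (star p)) := by
      rcases m with _ | m
      · simp
      · rw [← mul_assoc, ← pow_succ', Nat.add_sub_cancel]
    have h3 : distVar p ^ (m + 1) * starExp (star p)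
        = distVar p * (distVar p ^ m * starExp (star p)) := by rw [pow_succ', mul_assoc]
    have h4 : ((m + 1 : ℕ) : ℝ) • (distVar p ^ m * starExp (star p))
        = (m : ℝ) • (distVar p ^ m * starExp (star p)) + distVar p ^ m * starExp (star p) := by
      rw [Nat.cast_succ, add_smul, one_smul]
    rw [Nat.add_sub_cancel, h4, ← add_assoc, ← h1, ← h2, h3, raise_distVar_mul, ih, mul_add,
      mul_smul_comm]

/-- Conjugating `q̄ - ∂_q` by `e_*^{[q, p̄]}` turns it into `q̄ - p̄ - ∂_q`. -/
theorem raise_pow_distVar_pow_mul_starExp (p : ℍ[ℝ]) (m k : ℕ) :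
    (raise ^ k) (distVar p ^ m * starExp (star p))
      = (∑ i ∈ Finset.range (k + 1), ((1 : ℝ) ^ i * (k.choose i : ℝ) * (m.descFactorial i : ℝ)) •
          (distVar p ^ (m - i) * distVarConj p ^ (k - i))) * starExp (star p) := by
  induction k generalizing m with
  | zero => simp
  | succ k ih =>
    rw [pow_succ, Module.End.mul_apply, raise_distVar_pow_mul_starExp, map_add, map_smul,
      raise_pow_distVarConj_mul, ih, ih,
      sum_choose_descFactorial_succ (commute_distVar_distVarConj p), add_mul, smul_mul_assoc,
      one_mul, mul_assoc]

/-- The generating series `∑_j \overline{H_{j,k}(p)} q^j / j!`. -/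
def hermiteGen (k : ℕ) (p : ℍ[ℝ]) : PowerSeries ℍ[ℝ] :=
  PowerSeries.mk fun j => ((j ! : ℝ))⁻¹ • star (hermiteQ j k p)

theorem coeff_hermiteGen (k : ℕ) (p : ℍ[ℝ]) (j : ℕ) :
    PowerSeries.coeff j (hermiteGen k p) = ((j ! : ℝ))⁻¹ • star (hermiteQ j k p) :=
  PowerSeries.coeff_mk _ _

/-- Multiplication by `p - q` raises the index of the generating series, so that
`C_hermiteGen` follows by induction. -/
theorem hermiteGen_succ (k : ℕ) (p : ℍ[ℝ]) :
    hermiteGen (k + 1) p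
      = PowerSeries.C p * hermiteGen k p - PowerSeries.X * hermiteGen k p := by
  have h : ∀ j, star (hermiteQ j k p) * p = p * star (hermiteQ j k p) := fun j => by
    have := (commute_star_hermiteQ j k p).star_star.eq
    rw [star_star] at this
    exact this.symm
  ext1 j
  rw [map_sub, PowerSeries.coeff_C_mul, coeff_hermiteGen, coeff_hermiteGen, hermiteQ_succ_right,
    star_sub, star_mul, star_star, h, Quaternion.star_smul, smul_sub, mul_smul_comm]
  congr 1
  rcases j with _ | j
  · simp
  · rw [PowerSeries.coeff_succ_X_mul, coeff_hermiteGen, smul_smul, Nat.add_sub_cancel,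
      Nat.factorial_succ]
    congr 1
    push_cast
    field_simp

theorem C_hermiteGen (k : ℕ) (p : ℍ[ℝ]) :
    (Polynomial.C (hermiteGen k p) : SPSeries) = distVar p ^ k * starExp (star p) := by
  induction k with
  | zero =>
    rw [pow_zero, one_mul, starExp]
    congr 1
    ext1 j
    simp [coeff_hermiteGen]
  | succ k ih =>
    rw [hermiteGen_succ, Polynomial.C_sub, Polynomial.C_mul, Polynomial.C_mul, ih, pow_succ',
      mul_assoc, distVar, sub_mul]
    rfl

theorem coeff_laguerre (a m r : ℕ) :
    (laguerre a m).coeff r = (-1) ^ r * ((a + m).choose (a + r) : ℝ) / r ! := by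
  rw [laguerre, Polynomial.finsetSum_coeff]
  simp only [Polynomial.coeff_C_mul, Polynomial.coeff_X_pow, mul_ite, mul_one, mul_zero,
    Finset.sum_ite_eq, Finset.mem_range]
  split_ifs with h
  · rw [Nat.cast_choose ℝ (by omega : a + r ≤ a + m), Nat.add_sub_add_left]
    field_simp
  · rw [Nat.choose_eq_zero_of_lt (by omega)]
    simp

/-- By the hockey-stick identity for binomial coefficients, the kernels of exact level `k ≤ n` add
up to the kernel of the space of first kind. -/
theorem laguerre_one (n : ℕ) : laguerre 1 n = ∑ k ∈ Finset.range (n + 1), laguerre 0 k := by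
  induction n with
  | zero =>
    ext r
    rw [Finset.sum_range_one, coeff_laguerre, coeff_laguerre]
    rcases r with _ | r
    · simp
    · simp [Nat.choose_eq_zero_of_lt (by omega : 1 < 1 + (r + 1))]
  | succ n ih =>
    rw [Finset.sum_range_succ, ← ih]
    ext r
    rw [Polynomial.coeff_add, coeff_laguerre, coeff_laguerre, coeff_laguerre, ← add_assoc 1 n 1,
      add_comm 1 r, Nat.choose_succ_succ, add_comm 1 n, zero_add, zero_add]
    push_cast
    ring

theorem natDegree_laguerre_lt (a m : ℕ) : (laguerre a m).natDegree < m + 1 := by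
  rw [Nat.lt_succ_iff, Polynomial.natDegree_le_iff_coeff_eq_zero]
  intro r hr
  rw [coeff_laguerre, Nat.choose_eq_zero_of_lt (by omega)]
  simp

/-- The kernel of exact level `k` as the image of `∑_j \overline{H_{j,k}(p)} q^j / j!` under
`(q̄ - ∂_q)^k`. -/
theorem kernelSeries_zero (k : ℕ) (p : ℍ[ℝ]) :
    kernelSeries 0 k p
      = (Real.pi * k !)⁻¹ • (raise ^ k) (Polynomial.C (hermiteGen k p)) := by
  have hc : Commute (starLaguerre 0 k p) (starExp (star p)) := by
    have h : Commute (starDistSq p) (starExp (star p)) := by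
      rw [starDistSq_eq]
      exact ((commute_distVar_starExp p).mul_left (commute_distVarConj_starExp p)).neg_left
    rw [starLaguerre, Polynomial.aeval_eq_sum_range]
    exact Commute.sum_left _ _ _ fun i _ => (h.pow_left i).smul_left _
  rw [kernelSeries, ← hc.eq, C_hermiteGen, raise_pow_distVar_pow_mul_starExp, mul_inv, mul_smul,
    ← smul_mul_assoc (k ! : ℝ)⁻¹]
  congr 2
  rw [starLaguerre, Polynomial.aeval_eq_sum_range' (natDegree_laguerre_lt 0 k), Finset.smul_sum,
    ← Finset.sum_range_reflect]
  refine Finset.sum_congr rfl fun i hi => ?_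
  rw [Finset.mem_range, Nat.lt_succ_iff] at hi
  rw [coeff_laguerre, starDistSq_eq, ← neg_one_smul ℝ (distVar p * distVarConj p), smul_pow,
    (commute_distVar_distVarConj p).mul_pow, smul_smul, smul_smul, Nat.add_sub_cancel]
  congr 1
  rw [Nat.descFactorial_eq_div hi, Nat.cast_div (Nat.factorial_dvd_factorial (Nat.sub_le k i))
    (by positivity), zero_add, zero_add, Nat.choose_symm hi, one_pow, one_mul]
  have : (-1 : ℝ) ^ (k - i) * (-1) ^ (k - i) = 1 := by rw [← mul_pow]; simp
  field_simp
  linear_combination (k.choose i : ℝ) * this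

theorem kernelSeries_one (n : ℕ) (p : ℍ[ℝ]) :
    kernelSeries 1 n p = ∑ k ∈ Finset.range (n + 1), kernelSeries 0 k p := by
  simp only [kernelSeries, starLaguerre, laguerre_one, map_sum, Finset.mul_sum, Finset.smul_sum]

/-! ### Everywhere convergent series -/

/-- A power series which converges absolutely on the whole space. -/
def IsEntire (f : PowerSeries ℍ[ℝ]) : Prop :=
  ∀ r : ℝ, 0 ≤ r → Summable fun j => ‖PowerSeries.coeff j f‖ * r ^ j

namespace IsEntire

variable {f g : PowerSeries ℍ[ℝ]}

theorem add (hf : IsEntire f) (hg : IsEntire g) : IsEntire (f + g) := fun r hr => by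
  refine Summable.of_nonneg_of_le (fun j => by positivity) (fun j => ?_) ((hf r hr).add (hg r hr))
  rw [map_add, ← add_mul]
  gcongr
  exact norm_add_le _ _

theorem smul (hf : IsEntire f) (s : ℝ) : IsEntire (s • f) := fun r hr => by
  have : ∀ j, PowerSeries.coeff j (s • f) = s • PowerSeries.coeff j f := fun j => rfl
  simpa only [this, norm_smul, mul_assoc] using (hf r hr).mul_left ‖s‖

theorem zero : IsEntire 0 := fun r _ => by simp

theorem psDeriv (hf : IsEntire f) : IsEntire (psDeriv f) := fun r hr => by
  have h := (summable_nat_add_iff 1).2 (hf (2 * (1 + r)) (by positivity))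
  refine Summable.of_nonneg_of_le (fun j => by positivity) (fun j => ?_) h
  rw [coeff_psDeriv, norm_smul, Real.norm_of_nonneg (by positivity), mul_pow,
    mul_comm _ ‖_‖, mul_assoc]
  have h1 : (j : ℝ) + 1 ≤ 2 ^ (j + 1) := by exact_mod_cast (Nat.lt_two_pow_self (n := j + 1)).le
  have h2 : r ^ j ≤ (1 + r) ^ (j + 1) :=
    (pow_le_pow_left₀ hr (by linarith) j).trans (pow_le_pow_right₀ (by linarith) j.le_succ)
  gcongr

theorem summable_norm (hf : IsEntire f) (q : ℍ[ℝ]) :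
    Summable fun j => ‖q ^ j * PowerSeries.coeff j f‖ := by
  simpa only [norm_mul, norm_pow, mul_comm] using hf ‖q‖ (norm_nonneg q)

/-- Since `H_{j,k}` grows at most geometrically in `j`, Hermite series with the coefficients of an
entire series converge, uniformly on bounded sets. -/
theorem summable_hermite_bound (hf : IsEntire f) (k : ℕ) (r : ℝ) (hr : 0 ≤ r) :
    Summable fun j => k ! * Real.exp (1 + r) * (Real.exp 1 * (1 + r)) ^ j
      * ‖PowerSeries.coeff j f‖ := by
  simpa only [mul_assoc, mul_comm, mul_left_comm] using
    (hf (Real.exp 1 * (1 + r)) (by positivity)).mul_left (k ! * Real.exp (1 + r))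

end IsEntire

theorem norm_spTerm (F : SPSeries) (q : ℍ[ℝ]) (k j : ℕ) :
    ‖spTerm F q k j‖ = ‖q‖ ^ k * (‖PowerSeries.coeff j (F.coeff k)‖ * ‖q‖ ^ j) := by
  simp only [spTerm, norm_mul, norm_pow, Quaternion.norm_star]
  ring

theorem spConverges_iff {F : SPSeries} : SPConverges F ↔ ∀ k, IsEntire (F.coeff k) := by
  refine ⟨fun h k r hr => ?_, fun h q k => Summable.of_norm ?_⟩
  · have h1 := summable_norm_iff.2 (h ((r + 1 : ℝ) : ℍ[ℝ]) k)
    simp only [norm_spTerm] at h1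
    have hn : ‖((r + 1 : ℝ) : ℍ[ℝ])‖ = r + 1 := by
      rw [Quaternion.norm_coe, Real.norm_of_nonneg (by positivity)]
    rw [hn, summable_mul_left_iff (by positivity)] at h1
    refine Summable.of_nonneg_of_le (fun j => by positivity) (fun j => ?_) h1
    gcongr
    linarith
  · simp only [norm_spTerm]
    exact (h k ‖q‖ (norm_nonneg q)).mul_left _

theorem SPConverges.add {F G : SPSeries} (hF : SPConverges F) (hG : SPConverges G) :
    SPConverges (F + G) :=
  spConverges_iff.2 fun k => by
    rw [Polynomial.coeff_add]
    exact (spConverges_iff.1 hF k).add (spConverges_iff.1 hG k)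

theorem SPConverges.smul {F : SPSeries} (hF : SPConverges F) (s : ℝ) : SPConverges (s • F) :=
  spConverges_iff.2 fun k => by
    rw [Polynomial.coeff_smul]
    exact (spConverges_iff.1 hF k).smul s

theorem SPConverges.sub {F G : SPSeries} (hF : SPConverges F) (hG : SPConverges G) :
    SPConverges (F - G) := by
  rw [sub_eq_add_neg, ← neg_one_smul ℝ G]
  exact hF.add (hG.smul _)

theorem SPConverges.sum {ι : Type*} (s : Finset ι) {F : ι → SPSeries}
    (hF : ∀ i ∈ s, SPConverges (F i)) : SPConverges (∑ i ∈ s, F i) :=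
  Finset.sum_induction _ _ (fun _ _ => SPConverges.add)
    (spConverges_iff.2 fun _ => by rw [Polynomial.coeff_zero]; exact IsEntire.zero) hF

theorem IsEntire.spConverges_C {f : PowerSeries ℍ[ℝ]} (hf : IsEntire f) :
    SPConverges (Polynomial.C f) :=
  spConverges_iff.2 fun k => by
    rw [Polynomial.coeff_C]
    split_ifs
    exacts [hf, IsEntire.zero]

theorem coeff_raise_succ (F : SPSeries) (k : ℕ) :
    (raise F).coeff (k + 1) = F.coeff k - psDeriv (F.coeff (k + 1)) := by
  rw [raise_apply, Polynomial.coeff_sub, coeff_spDeriv, spVarConj, Polynomial.coeff_X_mul]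

theorem SPConverges.spVarConj_mul {F : SPSeries} (hF : SPConverges F) :
    SPConverges (spVarConj * F) :=
  spConverges_iff.2 fun k => by
    rw [spVarConj]
    rcases k with _ | k
    · rw [Polynomial.coeff_X_mul_zero]
      exact IsEntire.zero
    · rw [Polynomial.coeff_X_mul]
      exact spConverges_iff.1 hF k

theorem SPConverges.raise {F : SPSeries} (hF : SPConverges F) : SPConverges (raise F) :=
  hF.spVarConj_mul.sub (spConverges_iff.2 fun k => by
    rw [coeff_spDeriv]
    exact (spConverges_iff.1 hF k).psDeriv)

theorem SPConverges.raise_pow {F : SPSeries} (hF : SPConverges F) (k : ℕ) :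
    SPConverges ((_root_.raise ^ k) F) := by
  induction k with
  | zero => simpa using hF
  | succ k ih =>
    rw [pow_succ', Module.End.mul_apply]
    exact ih.raise

theorem natDegree_raise_pow_C_le (f : PowerSeries ℍ[ℝ]) (k : ℕ) :
    ((raise ^ k) (Polynomial.C f)).natDegree ≤ k := by
  induction k with
  | zero => simp
  | succ k ih =>
    rw [pow_succ', Module.End.mul_apply, Polynomial.natDegree_le_iff_coeff_eq_zero]
    rw [Polynomial.natDegree_le_iff_coeff_eq_zero] at ih
    intro N hN
    obtain ⟨N, rfl⟩ : ∃ M, N = M + 1 := ⟨N - 1, by omega⟩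
    rw [coeff_raise_succ, ih N (by omega), ih (N + 1) (by omega), map_zero, sub_zero]

theorem coeff_raise_pow_C (f : PowerSeries ℍ[ℝ]) (k : ℕ) :
    ((raise ^ k) (Polynomial.C f)).coeff k = f := by
  induction k with
  | zero => simp
  | succ k ih =>
    rw [pow_succ', Module.End.mul_apply, coeff_raise_succ, ih,
      Polynomial.coeff_eq_zero_of_natDegree_lt
        ((natDegree_raise_pow_C_le f k).trans_lt k.lt_succ_self), map_zero, sub_zero]

/-- The operator `raise` creates the leading power of `q̄`, so that the leading coefficients can be
split off one after the other. -/
theorem SPConverges.exists_eq_sum_raise {n : ℕ} {F : SPSeries} (hn : F.natDegree ≤ n)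
    (hF : SPConverges F) :
    ∃ f : ℕ → PowerSeries ℍ[ℝ], (∀ k, IsEntire (f k)) ∧
      F = ∑ k ∈ Finset.range (n + 1), (_root_.raise ^ k) (Polynomial.C (f k)) := by
  induction n generalizing F with
  | zero =>
    refine ⟨fun _ => F.coeff 0, fun _ => spConverges_iff.1 hF 0, ?_⟩
    simpa using Polynomial.eq_C_of_natDegree_le_zero hn
  | succ n ih =>
    set L := (_root_.raise ^ (n + 1)) (Polynomial.C (F.coeff (n + 1)))
    have hG : (F - L).natDegree ≤ n := by
      rw [Polynomial.natDegree_le_iff_coeff_eq_zero]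
      intro N hN
      rw [Polynomial.coeff_sub]
      rcases (Nat.succ_le_of_lt hN).eq_or_lt with rfl | hN'
      · rw [Nat.succ_eq_add_one, coeff_raise_pow_C, sub_self]
      · rw [Polynomial.coeff_eq_zero_of_natDegree_lt (hn.trans_lt hN'),
          Polynomial.coeff_eq_zero_of_natDegree_lt
            ((natDegree_raise_pow_C_le _ _).trans_lt hN'), sub_zero]
    have hent := spConverges_iff.1 hF (n + 1)
    obtain ⟨f, hf, hfs⟩ := ih hG (hF.sub (hent.spConverges_C.raise_pow (n + 1)))
    refine ⟨fun k => if k = n + 1 then F.coeff (n + 1) else f k, fun k => ?_, ?_⟩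
    · dsimp only
      split_ifs
      exacts [hent, hf k]
    · have h : ∀ k ∈ Finset.range (n + 1), (_root_.raise ^ k) (Polynomial.C (f k))
          = (_root_.raise ^ k) (Polynomial.C (if k = n + 1 then F.coeff (n + 1) else f k)) :=
        fun k hk => by rw [if_neg (Finset.mem_range.1 hk).ne]
      rw [Finset.sum_congr rfl h] at hfs
      dsimp only
      rw [Finset.sum_range_succ, ← hfs, if_pos rfl, sub_add_cancel]

/-! ### Sums of series -/

theorem spEval_eq_sum {F : SPSeries} {n : ℕ} (hn : F.natDegree ≤ n) (q : ℍ[ℝ]) :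
    spEval F q = ∑ k ∈ Finset.range (n + 1), ∑' j, spTerm F q k j := by
  refine Finset.sum_subset (Finset.range_mono (Nat.succ_le_succ hn)) fun k _ hk => ?_
  rw [Finset.mem_range, not_lt] at hk
  simp [spTerm, Polynomial.coeff_eq_zero_of_natDegree_lt (Nat.lt_of_succ_le hk)]

theorem spEval_add {F G : SPSeries} (hF : SPConverges F) (hG : SPConverges G) (q : ℍ[ℝ]) :
    spEval (F + G) q = spEval F q + spEval G q := by
  rw [spEval_eq_sum (le_max_left F.natDegree G.natDegree),
    spEval_eq_sum (le_max_right F.natDegree G.natDegree),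
    spEval_eq_sum (Polynomial.natDegree_add_le F G), ← Finset.sum_add_distrib]
  refine Finset.sum_congr rfl fun k _ => ?_
  rw [← (hF q k).tsum_add (hG q k)]
  simp only [spTerm, Polynomial.coeff_add, map_add, mul_add]

theorem spEval_smul (F : SPSeries) (s : ℝ) (q : ℍ[ℝ]) :
    spEval (s • F) q = s • spEval F q := by
  rw [spEval_eq_sum (Polynomial.natDegree_smul_le s F), spEval, Finset.smul_sum]
  refine Finset.sum_congr rfl fun k _ => ?_
  have : ∀ j, spTerm (s • F) q k j = s • spTerm F q k j := fun j => by
    rw [spTerm, spTerm, Polynomial.coeff_smul, ← mul_smul_comm]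
    rfl
  simp only [this]
  exact tsum_const_smul'' s

theorem spEval_sub {F G : SPSeries} (hF : SPConverges F) (hG : SPConverges G) (q : ℍ[ℝ]) :
    spEval (F - G) q = spEval F q - spEval G q := by
  rw [sub_eq_add_neg F G, ← neg_one_smul ℝ G, spEval_add hF (hG.smul _), spEval_smul,
    neg_one_smul, sub_eq_add_neg]

theorem spEval_sum {ι : Type*} (s : Finset ι) {F : ι → SPSeries}
    (hF : ∀ i ∈ s, SPConverges (F i)) (q : ℍ[ℝ]) :
    spEval (∑ i ∈ s, F i) q = ∑ i ∈ s, spEval (F i) q := by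
  classical
  induction s using Finset.induction_on with
  | empty => simp [spEval, spTerm]
  | insert i s hi ih =>
    rw [Finset.sum_insert hi, Finset.sum_insert hi,
      spEval_add (hF i (Finset.mem_insert_self i s))
        (SPConverges.sum s fun j hj => hF j (Finset.mem_insert_of_mem hj)),
      ih fun j hj => hF j (Finset.mem_insert_of_mem hj)]

theorem spEval_spVarConj_mul (F : SPSeries) (q : ℍ[ℝ]) :
    spEval (spVarConj * F) q = star q * spEval F q := by
  have h : (spVarConj * F).natDegree ≤ F.natDegree + 1 := by
    rw [add_comm]
    exact Polynomial.natDegree_mul_le_of_le Polynomial.natDegree_X_le le_rfl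
  rw [spEval_eq_sum h, Finset.sum_range_succ', spEval, Finset.mul_sum]
  have h0 : ∀ j, spTerm (spVarConj * F) q 0 j = 0 := fun j => by
    rw [spTerm, spVarConj, Polynomial.coeff_X_mul_zero, map_zero, mul_zero]
  have h1 : ∀ k j, spTerm (spVarConj * F) q (k + 1) j = star q * spTerm F q k j := fun k j => by
    rw [spTerm, spTerm, spVarConj, Polynomial.coeff_X_mul, pow_succ']
    simp only [mul_assoc]
  simp only [h0, h1, tsum_zero, add_zero, tsum_mul_left]

theorem spEval_C (f : PowerSeries ℍ[ℝ]) (q : ℍ[ℝ]) :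
    spEval (Polynomial.C f) q = ∑' j, q ^ j * PowerSeries.coeff j f := by
  simp [spEval, spTerm]

/-- Applying `(q̄ - ∂_q)^k` to `∑ q^j c_j` gives `∑ H_{j,k} c_j`. -/
theorem IsEntire.hasSum_hermite {f : PowerSeries ℍ[ℝ]} (hf : IsEntire f) (k : ℕ) (q : ℍ[ℝ]) :
    HasSum (fun j => hermiteQ j k q * PowerSeries.coeff j f)
      (spEval ((raise ^ k) (Polynomial.C f)) q) := by
  induction k generalizing f with
  | zero =>
    rw [pow_zero, Module.End.one_apply, spEval_C]
    simp only [hermiteQ_zero_right]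
    exact (hf.summable_norm q).of_norm.hasSum
  | succ k ih =>
    have h1 : HasSum (fun j : ℕ => ((j : ℝ) • hermiteQ (j - 1) k q) * PowerSeries.coeff j f)
        (spEval ((_root_.raise ^ k) (Polynomial.C (_root_.psDeriv f))) q) := by
      rw [← hasSum_nat_add_iff' 1]
      simpa only [Finset.sum_range_one, Nat.cast_zero, zero_smul, zero_mul, sub_zero,
        Nat.add_sub_cancel, coeff_psDeriv, Nat.cast_add, Nat.cast_one, smul_mul_assoc,
        mul_smul_comm] using ih hf.psDeriv
    have h2 := ((ih hf).mul_left (star q)).sub h1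
    rw [pow_succ, Module.End.mul_apply, raise_apply, spDeriv_C, map_sub, raise_pow_spVarConj_mul,
      spEval_sub (hf.spConverges_C.raise_pow k).spVarConj_mul
        (hf.psDeriv.spConverges_C.raise_pow k),
      spEval_spVarConj_mul]
    simpa only [hermiteQ_succ_right, sub_mul, mul_assoc] using h2

/-! ### The kernels as Hermite series -/

theorem isEntire_hermiteGen (k : ℕ) (p : ℍ[ℝ]) : IsEntire (hermiteGen k p) := fun r hr => by
  refine Summable.of_nonneg_of_le (fun j => by positivity) (fun j => ?_)
    ((Real.summable_pow_div_factorial (Real.exp 1 * (1 + ‖p‖) * r)).mul_left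
      (k ! * Real.exp (1 + ‖p‖)))
  rw [coeff_hermiteGen, norm_smul, norm_inv, Quaternion.norm_star, Real.norm_natCast]
  calc _ ≤ (j ! : ℝ)⁻¹ * (k ! * Real.exp (1 + ‖p‖) * (Real.exp 1 * (1 + ‖p‖)) ^ j) * r ^ j := by
        gcongr
        exact norm_hermiteQ_le_geometric j k p
    _ = _ := by
        rw [mul_pow _ r]
        ring

theorem spConverges_kernelSeries_zero (k : ℕ) (p : ℍ[ℝ]) : SPConverges (kernelSeries 0 k p) := by
  rw [kernelSeries_zero]
  exact ((isEntire_hermiteGen k p).spConverges_C.raise_pow k).smul _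

theorem spConverges_kernelSeries_one (n : ℕ) (p : ℍ[ℝ]) : SPConverges (kernelSeries 1 n p) := by
  rw [kernelSeries_one]
  exact SPConverges.sum _ fun k _ => spConverges_kernelSeries_zero k p

theorem hasSum_spEval_kernelSeries_zero (k : ℕ) (p q : ℍ[ℝ]) :
    HasSum (fun j => hermiteUnit k j q * star (hermiteUnit k j p))
      (spEval (kernelSeries 0 k p) q) := by
  rw [kernelSeries_zero, spEval_smul]
  convert ((isEntire_hermiteGen k p).hasSum_hermite k q).const_smul (Real.pi * k !)⁻¹ using 2 with j
  rw [coeff_hermiteGen, hermiteUnit, hermiteUnit, Quaternion.star_smul, smul_mul_smul_comm,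
    ← mul_inv, Real.mul_self_sqrt (by positivity), mul_smul_comm, smul_smul]
  congr 1
  rw [← mul_inv]
  congr 1
  ring

theorem hasSum_fintype_prod {κ ι M : Type*} [Fintype κ] [AddCommMonoid M] [TopologicalSpace M]
    [ContinuousAdd M] {g : κ × ι → M} {s : κ → M} (h : ∀ k, HasSum (fun i => g (k, i)) (s k)) :
    HasSum g (∑ k, s k) := by
  classical
  have h1 : ∀ k, HasSum (fun x : κ × ι => if x.1 = k then g x else 0) (s k) := fun k => by
    refine (Function.Injective.hasSum_iff (Prod.mk_right_injective k) fun x hx => ?_).1 ?_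
    · refine if_neg fun hxk => hx ⟨x.2, ?_⟩
      rw [← hxk]
    · simpa [Function.comp_def] using h k
  simpa using hasSum_sum fun k (_ : k ∈ Finset.univ) => h1 k

theorem hasSum_spEval_kernelSeries_one (n : ℕ) (p q : ℍ[ℝ]) :
    HasSum (fun i : Fin (n + 1) × ℕ => hermiteUnit i.1 i.2 q * star (hermiteUnit i.1 i.2 p))
      (spEval (kernelSeries 1 n p) q) := by
  rw [kernelSeries_one, spEval_sum _ fun k _ => spConverges_kernelSeries_zero k p,
    Finset.sum_range]
  exact hasSum_fintype_prod fun k => hasSum_spEval_kernelSeries_zero k p q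

/-! ### Polyregularity of the sums of series -/

/-- The sum `∑ q^j c_j` of a power series. -/
def psEval (f : PowerSeries ℍ[ℝ]) (q : ℍ[ℝ]) : ℍ[ℝ] := ∑' j, q ^ j * PowerSeries.coeff j f

theorem spEval_eq_sum_psEval {F : SPSeries} {n : ℕ} (hn : F.natDegree ≤ n) (q : ℍ[ℝ]) :
    spEval F q = ∑ k ∈ Finset.range (n + 1), star q ^ k * psEval (F.coeff k) q := by
  rw [spEval_eq_sum hn]
  refine Finset.sum_congr rfl fun k _ => ?_
  simp only [spTerm, psEval, mul_assoc, tsum_mul_left]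

theorem IsEntire.contDiff_psEval {f : PowerSeries ℍ[ℝ]} (hf : IsEntire f) {n : WithTop ℕ∞} :
    ContDiff ℝ n (psEval f) := by
  let p : FormalMultilinearSeries ℝ ℍ[ℝ] ℍ[ℝ] := fun j =>
    ((ContinuousLinearMap.mul ℝ ℍ[ℝ]).flip
      (PowerSeries.coeff j f)).compContinuousMultilinearMap
        (ContinuousMultilinearMap.mkPiAlgebraFin ℝ j ℍ[ℝ])
  have hp : ∀ j, ‖p j‖ ≤ ‖PowerSeries.coeff j f‖ := fun j => by
    refine (ContinuousLinearMap.norm_compContinuousMultilinearMap_le _ _).trans ?_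
    rw [ContinuousMultilinearMap.norm_mkPiAlgebraFin, mul_one]
    exact ContinuousLinearMap.opNorm_le_bound _ (norm_nonneg _) fun x => by
      rw [ContinuousLinearMap.flip_apply, ContinuousLinearMap.mul_apply', norm_mul, mul_comm]
  have hr : p.radius = ⊤ := p.radius_eq_top_of_summable_norm fun r =>
    Summable.of_nonneg_of_le (fun j => by positivity)
      (fun j => mul_le_mul_of_nonneg_right (hp j) (by positivity)) (hf r r.coe_nonneg)
  have hball := p.hasFPowerSeriesOnBall (by rw [hr]; exact ENNReal.zero_lt_top)
  rw [hr] at hball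
  have hsum : p.sum = psEval f := by
    funext q
    refine tsum_congr fun j => ?_
    simp [p]
  rw [hsum] at hball
  have h : AnalyticOnNhd ℝ (psEval f) Set.univ := fun q _ =>
    hball.analyticAt_of_mem (by simp)
  exact h.contDiff

instance : StarModule ℝ ℍ[ℝ] := ⟨fun r a => by rw [Quaternion.star_smul, star_trivial r]⟩

theorem SPConverges.contDiff_spEval {F : SPSeries} (hF : SPConverges F) {n : WithTop ℕ∞} :
    ContDiff ℝ n (spEval F) := by
  have h : spEval F
      = fun q => ∑ k ∈ Finset.range (F.natDegree + 1), star q ^ k * psEval (F.coeff k) q :=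
    funext fun q => spEval_eq_sum_psEval le_rfl q
  rw [h]
  have hs : ContDiff ℝ n (fun q : ℍ[ℝ] => star q) := (starL' ℝ : ℍ[ℝ] ≃L[ℝ] ℍ[ℝ]).contDiff
  exact ContDiff.sum fun k _ => (hs.pow k).mul (spConverges_iff.1 hF k).contDiff_psEval

section Dbar

variable {I : ℍ[ℝ]}

theorem contDiff_slice (hI : I ∈ imagUnits) {n : WithTop ℕ∞} : ContDiff ℝ n (slice I) := by
  rw [show slice I = sliceL hI from funext fun z => (sliceL_apply hI z).symm]
  exact (sliceL hI).contDiff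

theorem IsEntire.differentiable_psEval_slice {f : PowerSeries ℍ[ℝ]} (hf : IsEntire f)
    (hI : I ∈ imagUnits) : Differentiable ℝ fun z => psEval f (slice I z) :=
  (hf.contDiff_psEval.comp (contDiff_slice hI)).differentiable (n := 1) one_ne_zero

/-- Termwise differentiation of a power series along a slice. -/
theorem IsEntire.hasDerivAt_psEval_slice {f : PowerSeries ℍ[ℝ]} (hf : IsEntire f)
    (hI : I ∈ imagUnits) (z v : ℂ) :
    HasDerivAt (fun t : ℝ => psEval f (slice I (z + t * v)))
      (slice I v * psEval (_root_.psDeriv f) (slice I z)) 0 := by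
  have hterm : ∀ (j : ℕ) (t : ℝ), HasDerivAt
      (fun t : ℝ => slice I (z + t * v) ^ j * PowerSeries.coeff j f)
      (slice I (j * (z + t * v) ^ (j - 1) * v) * PowerSeries.coeff j f) t := fun j t => by
    have h1 : HasDerivAt (fun t : ℝ => z + t * v) v t := by
      simpa using ((Complex.ofRealCLM.hasDerivAt (x := t)).mul_const v).const_add z
    have h2 := ((sliceL hI).hasFDerivAt.comp_hasDerivAt t (h1.pow j)).mul_const
      (PowerSeries.coeff j f)
    have h3 : ∀ w : ℂ, slice I (w ^ j) = slice I w ^ j := fun w => by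
      simp only [slice_eq_sliceHom hI, map_pow]
    simpa only [Function.comp_def, sliceL_apply, Pi.pow_apply, h3] using h2
  -- a bound for `‖z + t * v‖` when `|t| < 1`
  set R := ‖z‖ + ‖v‖
  have hb := (hf.psDeriv R (by positivity)).mul_right ‖v‖
  have hb' : Summable fun j : ℕ => (j : ℝ) * R ^ (j - 1) * ‖v‖ * ‖PowerSeries.coeff j f‖ := by
    rw [← summable_nat_add_iff 1]
    refine hb.congr fun j => ?_
    rw [coeff_psDeriv, norm_smul, Real.norm_of_nonneg (by positivity), Nat.add_sub_cancel]
    push_cast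
    ring
  have hmain := hasDerivAt_tsum_of_isPreconnected (t := Metric.ball (0 : ℝ) 1) hb'
    Metric.isOpen_ball
    (convex_ball (0 : ℝ) 1).isPreconnected (fun j t _ => hterm j t) (fun j t ht => by
      have ht' : ‖z + t * v‖ ≤ R := by
        refine (norm_add_le _ _).trans ?_
        rw [norm_mul, Complex.norm_real]
        have : ‖t‖ < 1 := by simpa using ht
        have := norm_nonneg v
        simp only [R]
        nlinarith
      rw [norm_mul, norm_slice hI, norm_mul, norm_mul, norm_pow, Complex.norm_natCast]
      gcongr) (Metric.mem_ball_self one_pos) (by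
      simpa using (hf.summable_norm (slice I z)).of_norm) (Metric.mem_ball_self one_pos)
  refine HasDerivAt.congr_deriv hmain (Eq.symm ?_)
  rw [psEval, ← tsum_mul_left]
  have hs : Summable fun j : ℕ =>
      slice I (j * (z + (0 : ℝ) * v) ^ (j - 1) * v) * PowerSeries.coeff j f := by
    refine Summable.of_norm_bounded hb' fun j => ?_
    rw [norm_mul, norm_slice hI, norm_mul, norm_mul, norm_pow, Complex.norm_natCast]
    have : ‖z + (0 : ℝ) * v‖ ≤ R := by simp [R]
    gcongr
  rw [hs.tsum_eq_zero_add]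
  have h0 : slice I 0 = 0 := by rw [slice_eq_sliceHom hI, map_zero]
  simp only [Nat.cast_zero, zero_mul, h0, zero_add, Nat.add_sub_cancel, Complex.ofReal_zero,
    add_zero]
  refine tsum_congr fun j => ?_
  have h1 : slice I (((j + 1 : ℕ) : ℂ) * z ^ j * v)
      = ((j : ℝ) + 1) • (slice I v * slice I z ^ j) := by
    have : ((j + 1 : ℕ) : ℂ) * z ^ j * v = ((j : ℝ) + 1) • (v * z ^ j) := by
      rw [Complex.real_smul]
      push_cast
      ring
    rw [this]
    simp only [slice_eq_sliceHom hI, map_smul, map_mul, map_pow]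
  rw [h1, coeff_psDeriv, smul_mul_assoc, mul_smul_comm, mul_smul_comm, mul_assoc]

theorem IsEntire.fderiv_psEval_slice {f : PowerSeries ℍ[ℝ]} (hf : IsEntire f)
    (hI : I ∈ imagUnits) (z v : ℂ) :
    fderiv ℝ (fun z => psEval f (slice I z)) z v
      = slice I v * psEval (_root_.psDeriv f) (slice I z) := by
  have h1 : HasDerivAt (fun t : ℝ => z + t * v) v 0 := by
    simpa using ((Complex.ofRealCLM.hasDerivAt (x := (0 : ℝ))).mul_const v).const_add z
  have h2 : HasFDerivAt (fun z => psEval f (slice I z))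
      (fderiv ℝ (fun z => psEval f (slice I z)) z) (z + (0 : ℝ) * v) := by
    simpa using (hf.differentiable_psEval_slice hI z).hasFDerivAt
  have h3 := h2.comp_hasDerivAt (0 : ℝ) h1
  simp only [Function.comp_def] at h3
  exact h3.unique (hf.hasDerivAt_psEval_slice hI z v)

theorem slice_one (I : ℍ[ℝ]) : slice I 1 = 1 := by simp [slice]

theorem slice_I (I : ℍ[ℝ]) : slice I Complex.I = I := by simp [slice]

theorem IsEntire.dbar_psEval_slice {f : PowerSeries ℍ[ℝ]} (hf : IsEntire f)
    (hI : I ∈ imagUnits) (z : ℂ) : dbar I (fun z => psEval f (slice I z)) z = 0 := by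
  rw [dbar, hf.fderiv_psEval_slice hI, hf.fderiv_psEval_slice hI, slice_one, slice_I, one_mul,
    ← mul_assoc, ← sq, show I ^ 2 = -1 from hI, neg_one_mul, add_neg_cancel, smul_zero]

/-- Leibniz' rule for `∂̄_I` needs the first factor to commute with `I`. -/
theorem dbar_mul {A G : ℂ → ℍ[ℝ]} {z : ℂ} (hA : DifferentiableAt ℝ A z)
    (hG : DifferentiableAt ℝ G z) (hc : Commute I (A z)) :
    dbar I (fun w => A w * G w) z = dbar I A z * G z + A z * dbar I G z := by
  have h : ∀ v, fderiv ℝ (fun w => A w * G w) z v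
      = A z * fderiv ℝ G z v + fderiv ℝ A z v * G z := fun v => by
    rw [fderiv_fun_mul' hA hG]
    simp
  rw [dbar, dbar, dbar, h, h, smul_mul_assoc, mul_smul_comm, ← smul_add]
  congr 1
  rw [mul_add, mul_add, add_mul, ← mul_assoc, hc.eq]
  noncomm_ring

theorem dbar_sum {ι : Type*} (s : Finset ι) {G : ι → ℂ → ℍ[ℝ]} {z : ℂ}
    (hG : ∀ i ∈ s, DifferentiableAt ℝ (G i) z) :
    dbar I (fun w => ∑ i ∈ s, G i w) z = ∑ i ∈ s, dbar I (G i) z := by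
  simp only [dbar]
  rw [fderiv_fun_sum hG]
  simp only [_root_.sum_apply, Finset.mul_sum, ← Finset.sum_add_distrib,
    Finset.smul_sum]

theorem differentiable_star_slice_pow (hI : I ∈ imagUnits) (k : ℕ) :
    Differentiable ℝ fun z => star (slice I z) ^ k := by
  have h : ContDiff ℝ 1 (fun z => star (slice I z)) :=
    (starL' ℝ : ℍ[ℝ] ≃L[ℝ] ℍ[ℝ]).contDiff.comp (contDiff_slice hI)
  exact (h.pow k).differentiable one_ne_zero

theorem commute_star_slice (hI : I ∈ imagUnits) (z : ℂ) : Commute I (star (slice I z)) := by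
  rw [star_slice hI]
  exact (Quaternion.coe_commute _ _).symm.add_right
    ((Commute.refl I).mul_right (Quaternion.coe_commute _ _).symm)

theorem dbar_star_slice (hI : I ∈ imagUnits) (z : ℂ) :
    dbar I (fun w => star (slice I w)) z = 1 := by
  have h : ∀ v, fderiv ℝ (fun w => star (slice I w)) z v = star (slice I v) := fun v => by
    have h1 : (fun w => star (slice I w))
        = ((starL' ℝ : ℍ[ℝ] ≃L[ℝ] ℍ[ℝ]) : ℍ[ℝ] →L[ℝ] ℍ[ℝ]).comp (sliceL hI) := by
      funext w
      simp [sliceL_apply]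
    rw [h1, ContinuousLinearMap.fderiv]
    simp [sliceL_apply]
  rw [dbar, h, h, slice_one, slice_I, star_one, star_of_mem_imagUnits hI, mul_neg, ← sq,
    show I ^ 2 = -1 from hI, neg_neg, ← two_smul ℝ, smul_smul]
  norm_num

theorem dbar_star_slice_pow (hI : I ∈ imagUnits) (k : ℕ) (z : ℂ) :
    dbar I (fun w => star (slice I w) ^ k) z = (k : ℝ) • star (slice I z) ^ (k - 1) := by
  induction k with
  | zero => simp [dbar]
  | succ k ih =>
    have hd := differentiable_star_slice_pow hI 1
    simp only [pow_one] at hd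
    simp only [pow_succ']
    rw [dbar_mul (hd z) (differentiable_star_slice_pow hI k z) (commute_star_slice hI z),
      dbar_star_slice hI, ih, one_mul, mul_smul_comm]
    rcases k with _ | k
    · simp
    · simp only [Nat.add_sub_cancel, ← pow_succ']
      push_cast
      module

/-- Each application of `∂̄_I` lowers the degree in `q̄` by one. -/
theorem iterate_dbar_sum_eq_zero (hI : I ∈ imagUnits) (m : ℕ) {f : ℕ → PowerSeries ℍ[ℝ]}
    (hf : ∀ k, IsEntire (f k)) :
    (dbar I)^[m] (fun w => ∑ k ∈ Finset.range m, star (slice I w) ^ k * psEval (f k) (slice I w))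
      = 0 := by
  induction m generalizing f with
  | zero =>
    funext w
    simp
  | succ m ih =>
    rw [Function.iterate_succ_apply]
    have h : dbar I (fun w => ∑ k ∈ Finset.range (m + 1),
          star (slice I w) ^ k * psEval (f k) (slice I w))
        = fun w => ∑ k ∈ Finset.range m,
          star (slice I w) ^ k * psEval (((k + 1 : ℕ) : ℝ) • f (k + 1)) (slice I w) := by
      funext z
      have hd : ∀ k, DifferentiableAt ℝ (fun w => psEval (f k) (slice I w)) z := fun k =>
        (hf k).differentiable_psEval_slice hI z
      rw [dbar_sum _ fun k _ => (differentiable_star_slice_pow hI k z).fun_mul (hd k),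
        Finset.sum_range_succ']
      have hk : ∀ k, dbar I (fun w => star (slice I w) ^ k * psEval (f k) (slice I w)) z
          = ((k : ℝ) • star (slice I z) ^ (k - 1)) * psEval (f k) (slice I z) := fun k => by
        rw [dbar_mul (differentiable_star_slice_pow hI k z) (hd k)
          ((commute_star_slice hI z).pow_right k), (hf k).dbar_psEval_slice hI, mul_zero, add_zero,
          dbar_star_slice_pow hI]
      simp only [hk, Nat.cast_zero, zero_smul, zero_mul, add_zero, Nat.add_sub_cancel]
      refine Finset.sum_congr rfl fun k _ => ?_
      have hs : ∀ (s : ℝ) (g : PowerSeries ℍ[ℝ]) (q : ℍ[ℝ]), psEval (s • g) q = s • psEval g q :=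
        fun s g q => by
          have : ∀ j, PowerSeries.coeff j (s • g) = s • PowerSeries.coeff j g := fun j => rfl
          simp only [psEval, this, mul_smul_comm]
          exact tsum_const_smul'' s
      rw [hs, smul_mul_assoc, mul_smul_comm]
    rw [h]
    exact ih fun k => (hf (k + 1)).smul _

theorem SPConverges.isSPolyregular {F : SPSeries} {n : ℕ} (hn : F.natDegree ≤ n)
    (hF : SPConverges F) : IsSPolyregular n (spEval F) := by
  refine ⟨hF.contDiff_spEval.differentiable (n := 1) one_ne_zero, fun I hI =>
    ⟨hF.contDiff_spEval.comp (contDiff_slice hI), fun z => ?_⟩⟩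
  simp only [spEval_eq_sum_psEval hn]
  exact congrFun (iterate_dbar_sum_eq_zero hI (n + 1) (spConverges_iff.1 hF)) z

end Dbar

/-! ### Coefficients of square integrable series -/

section Coefficients

variable {I : ℍ[ℝ]} {f : PowerSeries ℍ[ℝ]}

/-- Hermite polynomials of different degrees under rotations are orthogonal on every disc. -/
theorem setIntegral_star_hermiteQ_mul_hermiteQ_eq_zero (hI : I ∈ imagUnits) (R : ℝ)
    {m k m' k' : ℕ} (h : k + m' ≠ m + k') :
    ∫ z in Metric.closedBall 0 R, star (hermiteQ m k (slice I z)) * hermiteQ m' k' (slice I z)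
      ∂gaussMeasure = 0 := by
  simp only [star_hermiteQ_mul_slice hI]
  rw [ContinuousLinearMap.integral_comp_comm]
  · obtain ⟨u, hu, hne⟩ := exists_norm_eq_one_pow_mul_star_pow_ne_one h
    rw [← integral_indicator Metric.isClosed_closedBall.measurableSet,
      integral_gaussMeasure_eq_zero hu (fun z => ?_) hne, map_zero]
    have hmem : u * z ∈ Metric.closedBall (0 : ℂ) R ↔ z ∈ Metric.closedBall (0 : ℂ) R := by
      simp [hu]
    by_cases hz : z ∈ Metric.closedBall (0 : ℂ) R
    · rw [Set.indicator_of_mem (hmem.2 hz), Set.indicator_of_mem hz, hermiteC_mul hu,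
        hermiteC_mul hu]
      simp only [star_mul, star_pow, star_star]
      ring
    · rw [Set.indicator_of_notMem (mt hmem.1 hz), Set.indicator_of_notMem hz, mul_zero]
  · have := integrable_hermiteC_mul m k m' k' 0 0
    simp only [pow_zero, mul_one] at this
    exact this.integrableOn

theorem integrable_star_hermiteQ_mul_hermiteQ (hI : I ∈ imagUnits) (m k m' k' : ℕ) :
    Integrable (fun z => star (hermiteQ m k (slice I z)) * hermiteQ m' k' (slice I z))
      gaussMeasure :=
  (sliceL2_hermiteQ hI m k).integrable_star_mul (sliceL2_hermiteQ hI m' k')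

/-- On a disc, integrating a Hermite series against `\overline{H_{m,k}}` picks out a single term. -/
theorem IsEntire.setIntegral_star_hermiteQ_mul (hf : IsEntire f) (hI : I ∈ imagUnits)
    (m k k' : ℕ) {R : ℝ} (hR : 0 ≤ R) :
    ∫ z in Metric.closedBall 0 R, star (hermiteQ m k (slice I z))
        * spEval ((_root_.raise ^ k') (Polynomial.C f)) (slice I z) ∂gaussMeasure
      = if k ≤ m + k' then
          (∫ z in Metric.closedBall 0 R, star (hermiteQ m k (slice I z))
            * hermiteQ (m + k' - k) k' (slice I z) ∂gaussMeasure)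
          * PowerSeries.coeff (m + k' - k) f
        else 0 := by
  set B : Set ℂ := Metric.closedBall 0 R
  set b : ℕ → ℝ := fun j => k' ! * Real.exp (1 + R) * (Real.exp 1 * (1 + R)) ^ j
    * ‖PowerSeries.coeff j f‖
  set C : ℝ := k ! * Real.exp (1 + R) * (Real.exp 1 * (1 + R)) ^ m
  have hbound : ∀ z ∈ B, ∀ m k : ℕ, ‖hermiteQ m k (slice I z)‖
      ≤ k ! * Real.exp (1 + R) * (Real.exp 1 * (1 + R)) ^ m := fun z hz m k => by
    have hz' : ‖slice I z‖ ≤ R := by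
      rw [norm_slice hI]
      simpa [B] using hz
    refine (norm_hermiteQ_le_geometric m k _).trans ?_
    gcongr
  have hint : ∀ j : ℕ, Integrable (fun z => star (hermiteQ m k (slice I z))
      * hermiteQ j k' (slice I z) * PowerSeries.coeff j f) (gaussMeasure.restrict B) := fun j =>
    (((ContinuousLinearMap.mul ℝ ℍ[ℝ]).flip (PowerSeries.coeff j f)).integrable_comp
      (integrable_star_hermiteQ_mul_hermiteQ hI m k j k')).integrableOn
  have hsum := hasSum_integral_of_summable_integral_norm hint (by
    refine Summable.of_nonneg_of_le (fun j => integral_nonneg fun z => norm_nonneg _) (fun j => ?_)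
      ((hf.summable_hermite_bound k' R hR).mul_left (C * gaussMeasure.real B))
    refine (Real.le_norm_self _).trans ((norm_setIntegral_le_of_norm_le_const (C := C * b j)
      (measure_lt_top _ _) fun z hz => ?_).trans_eq (by simp only [b]; ring))
    rw [norm_norm, norm_mul, norm_mul, Quaternion.norm_star, mul_assoc]
    have h1 := hbound z hz m k
    have h2 := hbound z hz j k'
    exact mul_le_mul h1 (mul_le_mul_of_nonneg_right h2 (norm_nonneg _)) (by positivity)
      (by positivity))
  have hterm : ∀ j, ∫ z in B, star (hermiteQ m k (slice I z)) * hermiteQ j k' (slice I z)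
        * PowerSeries.coeff j f ∂gaussMeasure
      = (∫ z in B, star (hermiteQ m k (slice I z)) * hermiteQ j k' (slice I z) ∂gaussMeasure)
        * PowerSeries.coeff j f := fun j =>
    ((ContinuousLinearMap.mul ℝ ℍ[ℝ]).flip (PowerSeries.coeff j f)).integral_comp_comm
      (integrable_star_hermiteQ_mul_hermiteQ hI m k j k').integrableOn
  simp only [hterm] at hsum
  have heq : ∀ z, ∑' j, star (hermiteQ m k (slice I z)) * hermiteQ j k' (slice I z)
        * PowerSeries.coeff j f
      = star (hermiteQ m k (slice I z))
        * spEval ((_root_.raise ^ k') (Polynomial.C f)) (slice I z) := fun z => by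
    simp only [mul_assoc]
    rw [tsum_mul_left, (hf.hasSum_hermite k' _).tsum_eq]
  simp only [heq] at hsum
  refine hsum.unique ?_
  split_ifs with h
  · refine hasSum_single _ fun j hj => ?_
    rw [setIntegral_star_hermiteQ_mul_hermiteQ_eq_zero hI R (by omega), zero_mul]
  · convert hasSum_zero with j
    rw [setIntegral_star_hermiteQ_mul_hermiteQ_eq_zero hI R (by omega), zero_mul]

theorem tendsto_setIntegral_closedBall {g : ℂ → ℍ[ℝ]} (hg : Integrable g gaussMeasure) :
    Filter.Tendsto (fun N : ℕ => ∫ z in Metric.closedBall 0 (N : ℝ), g z ∂gaussMeasure)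
      Filter.atTop (nhds (∫ z, g z ∂gaussMeasure)) :=
  (aecover_closedBall tendsto_natCast_atTop_atTop).integral_tendsto_of_countably_generated hg

/-- The Hermite coefficients of a square integrable sum of Hermite series are the inner products
with the Hermite polynomials. As the series need not converge in `L²` a priori, the integral is
computed on discs. -/
theorem sliceInner_hermiteQ_sum (hI : I ∈ imagUnits) {n : ℕ} {f : ℕ → PowerSeries ℍ[ℝ]}
    (hf : ∀ k, IsEntire (f k)) {g : ℍ[ℝ] → ℍ[ℝ]} (hg : SliceL2 I g)
    (hgf : ∀ q, g q = ∑ k ∈ Finset.range (n + 1), spEval ((raise ^ k) (Polynomial.C (f k))) q)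
    (m : ℕ) {k : ℕ} (hk : k ≤ n) :
    sliceInner I (hermiteQ m k) g = (Real.pi * m ! * k !) • PowerSeries.coeff m (f k) := by
  have h1 := tendsto_setIntegral_closedBall ((sliceL2_hermiteQ hI m k).integrable_star_mul hg)
  have hcont : ∀ k', Continuous fun z => star (hermiteQ m k (slice I z))
      * spEval ((raise ^ k') (Polynomial.C (f k'))) (slice I z) := fun k' =>
    (((continuous_hermiteQ m k).comp (continuous_slice hI)).star).mul
      ((((hf k').spConverges_C.raise_pow k').contDiff_spEval (n := 0)).continuous.comp
        (continuous_slice hI))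
  have h2 : ∀ N : ℕ, ∫ z in Metric.closedBall 0 (N : ℝ),
        star (hermiteQ m k (slice I z)) * g (slice I z) ∂gaussMeasure
      = ∑ k' ∈ Finset.range (n + 1), if k ≤ m + k' then
          (∫ z in Metric.closedBall 0 (N : ℝ), star (hermiteQ m k (slice I z))
            * hermiteQ (m + k' - k) k' (slice I z) ∂gaussMeasure)
          * PowerSeries.coeff (m + k' - k) (f k')
        else 0 := fun N => by
    simp only [hgf, Finset.mul_sum]
    rw [integral_finsetSum _ fun k' _ =>
      (hcont k').continuousOn.integrableOn_compact (isCompact_closedBall 0 (N : ℝ))]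
    exact Finset.sum_congr rfl fun k' _ =>
      (hf k').setIntegral_star_hermiteQ_mul hI m k k' N.cast_nonneg
  simp only [h2] at h1
  have h3 := tendsto_finsetSum (Finset.range (n + 1)) fun k' (_ : k' ∈ Finset.range (n + 1)) =>
    show Filter.Tendsto (fun N : ℕ => if k ≤ m + k' then
          (∫ z in Metric.closedBall 0 (N : ℝ), star (hermiteQ m k (slice I z))
            * hermiteQ (m + k' - k) k' (slice I z) ∂gaussMeasure)
          * PowerSeries.coeff (m + k' - k) (f k')
        else 0) Filter.atTop (nhds (if k' = k then
          (Real.pi * m ! * k !) • PowerSeries.coeff m (f k) else 0)) by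
      by_cases h : k ≤ m + k'
      · simp only [if_pos h]
        have h4 := (tendsto_setIntegral_closedBall
          (integrable_star_hermiteQ_mul_hermiteQ hI m k (m + k' - k) k')).mul_const
            (PowerSeries.coeff (m + k' - k) (f k'))
        rw [show ∫ z, _ ∂gaussMeasure = _ from sliceInner_hermiteQ hI m k (m + k' - k) k'] at h4
        by_cases h' : k' = k
        · subst h'
          simpa only [Nat.add_sub_cancel, and_self, if_true, Quaternion.coe_mul_eq_smul] using h4
        · simpa only [h', false_and, if_false, zero_mul] using h4
      · simp only [if_neg h, if_neg (by omega : ¬k' = k)]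
        exact tendsto_const_nhds
  have h5 := tendsto_nhds_unique h1 h3
  rw [Finset.sum_ite_eq' , if_pos (Finset.mem_range.2 (by omega))] at h5
  exact h5

end Coefficients

/-! ### The Bargmann spaces as spans of Hermite polynomials -/

theorem hermiteUnit_mul_smul (k j : ℕ) (q a : ℍ[ℝ]) :
    hermiteUnit k j q * Real.sqrt (Real.pi * j ! * k !) • a = hermiteQ j k q * a := by
  rw [hermiteUnit, smul_mul_smul_comm, inv_mul_cancel₀ (sqrt_weight_pos j k).ne', one_smul]

theorem bargmannSecond_eq_sliceSpan (k : ℕ) : bargmannSecond k = sliceSpan (hermiteUnit k) := by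
  ext f
  constructor
  · rintro ⟨c, hc, hf⟩
    refine ⟨fun j => Real.sqrt (Real.pi * j ! * k !) • c j, ?_, fun q => ?_⟩
    · refine (hc.mul_left (Real.pi * k !)).congr fun j => ?_
      rw [norm_smul, mul_pow, Real.norm_of_nonneg (Real.sqrt_nonneg _),
        Real.sq_sqrt (by positivity)]
      ring
    · exact (hf q).congr_fun fun j => hermiteUnit_mul_smul k j q (c j)
  · rintro ⟨c, hc, hf⟩
    refine ⟨fun j => (Real.sqrt (Real.pi * j ! * k !))⁻¹ • c j, ?_, fun q => ?_⟩
    · refine (hc.mul_left (Real.pi * k !)⁻¹).congr fun j => ?_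
      rw [norm_smul, mul_pow, norm_inv, Real.norm_of_nonneg (Real.sqrt_nonneg _), inv_pow,
        Real.sq_sqrt (by positivity)]
      field_simp
    · refine (hf q).congr_fun fun j => ?_
      rw [hermiteUnit, smul_mul_assoc, mul_smul_comm]

/-- The normalization `√(π j! k!)` grows so fast that square summable coefficients, once divided by
it, are those of an entire series. -/
theorem isEntire_of_summable_norm_sq {k : ℕ} {c : ℕ → ℍ[ℝ]} (hc : Summable fun j => ‖c j‖ ^ 2) :
    IsEntire (PowerSeries.mk fun j => (Real.sqrt (Real.pi * j ! * k !))⁻¹ • c j) := fun r hr => by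
  refine Summable.of_nonneg_of_le (fun j => by positivity) (fun j => ?_)
    (hc.add ((Real.summable_pow_div_factorial (r ^ 2)).mul_left (Real.pi * k !)⁻¹))
  have h := two_mul_le_add_sq ‖c j‖ ((Real.sqrt (Real.pi * j ! * k !))⁻¹ * r ^ j)
  have h1 : ((Real.sqrt (Real.pi * j ! * k !))⁻¹ * r ^ j) ^ 2
      = (Real.pi * k !)⁻¹ * ((r ^ 2) ^ j / j !) := by
    rw [mul_pow, inv_pow, Real.sq_sqrt (by positivity), ← pow_mul, ← pow_mul, mul_comm j 2]
    field_simp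
  have h2 : 0 ≤ ‖c j‖ * ((Real.sqrt (Real.pi * j ! * k !))⁻¹ * r ^ j) := by positivity
  rw [PowerSeries.coeff_mk, norm_smul, norm_inv, Real.norm_of_nonneg (Real.sqrt_nonneg _)]
  rw [h1] at h
  linarith [show (Real.sqrt (Real.pi * j ! * k !))⁻¹ * ‖c j‖ * r ^ j
      = ‖c j‖ * ((Real.sqrt (Real.pi * j ! * k !))⁻¹ * r ^ j) by ring]

/-- A square integrable series of the first kind has square summable Hermite coefficients: they are
its inner products with an orthonormal family. -/
theorem bargmannFirst_subset_sliceSpan (n : ℕ) :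
    bargmannFirst n ⊆ sliceSpan fun i : Fin (n + 1) × ℕ => hermiteUnit i.1 i.2 := by
  rintro g ⟨⟨F, hn, hF, hgF⟩, -, I, hI, hg⟩
  obtain ⟨f, hf, rfl⟩ := hF.exists_eq_sum_raise hn
  have hgf : ∀ q, g q
      = ∑ k ∈ Finset.range (n + 1), spEval ((raise ^ k) (Polynomial.C (f k))) q := fun q => by
    rw [hgF, spEval_sum _ fun k _ => (hf k).spConverges_C.raise_pow k]
  refine ⟨fun i => Real.sqrt (Real.pi * i.2 ! * (i.1 : ℕ)!) • PowerSeries.coeff i.2 (f i.1), ?_,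
    fun q => ?_⟩
  · refine ((isSliceOrthonormal_hermiteUnit_fin hI n).summable_norm_sq_sliceInner hg).congr
      fun i => ?_
    have h1 : sliceInner I (hermiteUnit i.1 i.2) g
        = (Real.sqrt (Real.pi * i.2 ! * (i.1 : ℕ)!))⁻¹ • sliceInner I (hermiteQ i.2 i.1) g := by
      have := sliceInner_smul_smul I (hermiteQ i.2 i.1) g
        (Real.sqrt (Real.pi * i.2 ! * (i.1 : ℕ)!))⁻¹ 1
      simp only [one_smul, mul_one] at this
      exact this
    rw [h1, sliceInner_hermiteQ_sum hI hf hg hgf i.2 (Nat.lt_succ_iff.1 i.1.2), smul_smul]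
    congr 3
    rw [inv_mul_eq_div, Real.div_sqrt]
  · rw [hgf, Finset.sum_range]
    refine hasSum_fintype_prod fun k => ?_
    simpa only [hermiteUnit_mul_smul] using (hf k).hasSum_hermite k q

theorem sliceSpan_subset_bargmannFirst {I : ℍ[ℝ]} (hI : I ∈ imagUnits) (n : ℕ) :
    sliceSpan (fun i : Fin (n + 1) × ℕ => hermiteUnit i.1 i.2) ⊆ bargmannFirst n := by
  rintro g ⟨c, hc, hg⟩
  have hck : ∀ k : Fin (n + 1), Summable fun j => ‖c (k, j)‖ ^ 2 := fun k =>
    hc.comp_injective (Prod.mk_right_injective k)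
  have hent := fun k : Fin (n + 1) => isEntire_of_summable_norm_sq (k := k) (hck k)
  set f : Fin (n + 1) → PowerSeries ℍ[ℝ] := fun k =>
    PowerSeries.mk fun j => (Real.sqrt (Real.pi * j ! * (k : ℕ)!))⁻¹ • c (k, j)
  have hconv : ∀ k ∈ (Finset.univ : Finset (Fin (n + 1))),
      SPConverges ((raise ^ (k : ℕ)) (Polynomial.C (f k))) :=
    fun k _ => (hent k).spConverges_C.raise_pow k
  set F : SPSeries := ∑ k : Fin (n + 1), (raise ^ (k : ℕ)) (Polynomial.C (f k))
  have hn : F.natDegree ≤ n := Polynomial.natDegree_sum_le_of_forall_le _ _ fun k _ =>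
    (natDegree_raise_pow_C_le _ _).trans (Nat.lt_succ_iff.1 k.2)
  have hF : SPConverges F := SPConverges.sum _ hconv
  have hgF : ∀ q, g q = spEval F q := fun q => by
    rw [spEval_sum _ hconv]
    refine (hg q).unique (hasSum_fintype_prod fun k => ?_)
    refine ((hent k).hasSum_hermite k q).congr_fun fun j => ?_
    simp only [PowerSeries.coeff_mk, hermiteUnit, smul_mul_assoc, mul_smul_comm]
  refine ⟨⟨F, hn, hF, hgF⟩, ?_, I, hI, (isSliceOrthonormal_hermiteUnit_fin hI n).sliceL2 hc hg⟩
  rw [show g = spEval F from funext hgF]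
  exact hF.isSPolyregular hn

end

theorem mainTheorem1 :
    (∀ (n : ℕ), ∀ I ∈ imagUnits,
      (∀ p, SPConverges (kernelSeries 1 n p)) ∧
      IsReproducingKernelSpace I (bargmannFirst n) (fun p q => spEval (kernelSeries 1 n p) q)) ∧
    (∀ (k : ℕ), ∀ I ∈ imagUnits,
      (∀ p, SPConverges (kernelSeries 0 k p)) ∧
      IsReproducingKernelSpace I (bargmannSecond k) (fun p q => spEval (kernelSeries 0 k p) q)) := by
  refine ⟨fun n I hI => ⟨spConverges_kernelSeries_one n, ?_⟩,
    fun k I hI => ⟨spConverges_kernelSeries_zero k, ?_⟩⟩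
  · rw [(bargmannFirst_subset_sliceSpan n).antisymm (sliceSpan_subset_bargmannFirst hI n)]
    exact (isSliceOrthonormal_hermiteUnit_fin hI n).isReproducingKernelSpace
      (hasSum_spEval_kernelSeries_one n)
  · rw [bargmannSecond_eq_sliceSpan]
    exact (isSliceOrthonormal_hermiteUnit hI k).isReproducingKernelSpace
      (hasSum_spEval_kernelSeries_zero k)
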